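/- Natural numbers are identified with binary strings, and $|x|$ denotes the length of $x$. A *total polynomial search problem* is a pair $(p,R)$, where $p$ is a polynomial and $R$ is a binary relation decidable in polynomial time such that for every $x$ there exists $y$ with $|y|\le p(|x|)$ and $R(x,y)$; every such $y$ is called a *solution* of the instance $x$. Let $\mathbf{TFNP}$ be the class of all total polynomial search problems. An oracle that *gives solutions* to $P\in\mathbf{TFNP}$ is a function $O$ such that, for every string $q$, $O(q)$ is a solution of the instance $q$ of $P$. A problem $Q\in\mathbf{TFNP}$ is *polynomially reducible* (or polynomially Turing reducible) to $P\in\mathbf{TFNP}$ if there are a deterministic oracle machine $M$ and a polynomial $t$ such that, for every oracle $O$ that gives solutions to $P$ and every $x$, the machine $M$ with oracle $O$ on input $x$ halts within $t(|x|)$ steps and outputs a solution of the instance $x$ of $Q$. It is *many-one polynomially reducible* to $P$ if, moreover, $M$ can be chosen so that it always asks exactly one oracle query. A problem $P\in\mathbf{TFNP}$ is *complete* with respect to a notion of reducibility if every $Q\in\mathbf{TFNP}$ is reducible to $P$ in that sense. **Lemma.** For every $P\in\mathbf{TFNP}$ there exists $P'\in\mathbf{TFNP}$ such that for every $Q\in\mathbf{TFNP}$,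 if $Q$ is polynomially reducible to $P$, then $Q$ is many-one polynomially reducible to $P'$. **Proposition (E. Jeřábek).** There exists a complete problem in $\mathbf{TFNP}$ with respect to polynomial reductions if and only if there exists a complete problem in $\mathbf{TFNP}$ with respect to many-one polynomial reductions. -/

import Mathlib

/-! Binary strings play the role of the natural numbers written in binary; the length `|x|` is
`List.length`.  Polynomials have natural-number coefficients. -/

namespace SearchProblems

open Polynomial

/-- Binary strings. -/
abbrev Str : Type := List Bool

/-! ### Deterministic multi-stack (oracle) Turing machines

A machine has finitely many states and works on stacks of bits (the work tapes; two stacks make up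
one two-way infinite tape), numbered by natural numbers; a machine, being a finite list
of instructions, only touches finitely many of them.  In one step it pushes a bit, or pops
a stack and branches on what it found, or asks the oracle. -/

/-- The action of a machine in one of its states.
* `push r b l`: push the bit `b` on stack `r` and go to state `l`;
* `pop r l₀ l₁ lₑ`: pop the top bit of stack `r` and go to state `l₀` if it is `false`, to `l₁` if
  it is `true`, and to `lₑ` if the stack is empty;
* `query l`: ask the oracle for the string on the query stack (stack `1`), erase the query stack,
  replace the contents of the answer stack (stack `2`) by the answer, and go to state `l`. -/
inductive Instr : Type
  | push (r : ℕ) (b : Bool) (l : ℕ)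
  | pop (r : ℕ) (l₀ l₁ lₑ : ℕ)
  | query (l : ℕ)

/-- A machine with states `0, …, M.length - 1`; the machine starts in state `0` and halts as soon
as it goes to a state `≥ M.length`. -/
abbrev Machine : Type := List Instr

/-- A configuration: the current state, the contents of the stacks (the head of a list is the
top of the stack), and the number of oracle queries asked so far. -/
structure Config : Type where
  state : ℕ
  stack : ℕ → Str
  queries : ℕ

/-- One step of the machine `M` with the oracle `O`; a halted configuration does not change. -/
def step (M : Machine) (O : Str → Str) (c : Config) : Config :=
  match M[c.state]? with
  | none => c
  | some (Instr.push r b l) =>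
      { c with state := l, stack := Function.update c.stack r (b :: c.stack r) }
  | some (Instr.pop r l₀ l₁ lₑ) =>
      match c.stack r with
      | [] => { c with state := lₑ }
      | b :: s => { c with state := if b then l₁ else l₀, stack := Function.update c.stack r s }
  | some (Instr.query l) =>
      { state := l
        stack := Function.update (Function.update c.stack 1 []) 2 (O (c.stack 1))
        queries := c.queries + 1 }

/-- The initial configuration: the input strings are on the stacks `0, 1, …`, all the other
stacks are empty. -/
def initial (inputs : List Str) : Config where
  state := 0
  stack r := inputs.getD r []
  queries := 0

/-- The configuration after `t` steps. -/
def run (M : Machine) (O : Str → Str) (inputs : List Str) (t : ℕ) : Config :=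
  (step M O)^[t] (initial inputs)

/-- The configuration `c` of the machine `M` is halted. -/
def Config.Halted (c : Config) (M : Machine) : Prop := M.length ≤ c.state

/-- The output: the contents of stack `0`. -/
def Config.output (c : Config) : Str := c.stack 0

/-- `M` is an ordinary machine: it never asks an oracle. -/
def Machine.QueryFree (M : Machine) : Prop := ∀ l : ℕ, Instr.query l ∉ M

open Classical in
/-- The binary relation `R` is decidable in polynomial time: some machine without oracle, started
with `x` and `y` on its stacks `0` and `1`, halts after at most `t(|x| + |y|)` steps, where `t` is a
polynomial, and outputs `1` if `R x y` and `0` otherwise.  (As the machine is query-free, the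
oracle `fun _ => []` is never used.) -/
def PolyTimeDecidable (R : Str → Str → Prop) : Prop :=
  ∃ (M : Machine) (t : ℕ[X]), M.QueryFree ∧ ∀ x y : Str,
    (run M (fun _ => []) [x, y] (t.eval (x.length + y.length))).Halted M ∧
    (run M (fun _ => []) [x, y] (t.eval (x.length + y.length))).output =
      if R x y then [true] else [false]

/-! ### Total polynomial search problems and reductions -/

/-- Total polynomial search problems `(p, R)`, that is, the elements of the class TFNP. -/
structure TFNP : Type where
  /-- the polynomial bound on the length of solutions -/
  bound : ℕ[X]
  /-- the relation -/
  rel : Str → Str → Prop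
  polyTime : PolyTimeDecidable rel
  total : ∀ x : Str, ∃ y : Str, y.length ≤ bound.eval x.length ∧ rel x y

/-- `y` is a solution of the instance `x` of the problem `P`. -/
def TFNP.IsSolution (P : TFNP) (x y : Str) : Prop :=
  y.length ≤ P.bound.eval x.length ∧ P.rel x y

/-- The oracle `O` gives solutions to `P`. -/
def TFNP.IsOracle (P : TFNP) (O : Str → Str) : Prop := ∀ q : Str, P.IsSolution q (O q)

/-- `Q` is polynomially (Turing) reducible to `P`: some oracle machine solves `Q` in polynomial
time with every oracle that gives solutions to `P`. -/
def TFNP.PolyReducible (Q P : TFNP) : Prop :=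
  ∃ (M : Machine) (t : ℕ[X]), ∀ O : Str → Str, P.IsOracle O → ∀ x : Str,
    (run M O [x] (t.eval x.length)).Halted M ∧
    Q.IsSolution x (run M O [x] (t.eval x.length)).output

/-- `Q` is many-one polynomially reducible to `P`: it is polynomially reducible to `P` by a machine
that asks exactly one query. -/
def TFNP.ManyOneReducible (Q P : TFNP) : Prop :=
  ∃ (M : Machine) (t : ℕ[X]), ∀ O : Str → Str, P.IsOracle O → ∀ x : Str,
    (run M O [x] (t.eval x.length)).Halted M ∧
    Q.IsSolution x (run M O [x] (t.eval x.length)).output ∧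
    (run M O [x] (t.eval x.length)).queries = 1

end SearchProblems

/-!
A Turing reduction to `P` becomes a reduction with one query when the query asks for all the answers
at once.  An instance of the problem `TFNP.universal P` is a string `pair code (pair z T)`,
read as the program of an oracle machine, an input `z`, and a number `|T|` of steps; a solution is
a table of pairs (query, answer) such that the program, run for `|T|` steps with answers looked up
in the table, only ever receives correct solutions of `P`.  As the answers are looked up in
a table, equal queries get equal answers, so that the run is a run with an oracle in the sense of
the definition of reductions (`TFNP.exists_isOracle_represents`).  Solutions always
exist: fix an oracle, and let the table list its answers to the queries of the run.  This table is
short because the query stack starts empty, is erased by each query and grows by at most one bit in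
each step, so that the queries have length at most `|T|` (`length_query_le`,
`iterate_ustep_table`); the length of the answers, however long, never enters the later
queries faster than one bit per step.  A machine `M` that reduces `Q` to `P` in time `t` thus gives
a reduction of `Q` to `universal P`: ask for a table for `M`, `x` and `t(|x|)`, and repeat the
simulation of `M` with it.

What remains is that the universal simulation, with the test of the answers, runs in polynomial
time.  Machines are composed by `seq` and `popBranch`, which yield sequencing, branching and loops.
Based on these, the class `PolyTime` of functions on strings contains the coding of pairs and is
closed under composition, pairing, branching (`PolyTime.branch`), and iteration with polynomially
bounded intermediate results (`PolyTime.iterate`).  The universal machine is then an iterated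
function in this class (`polyTime_universal`).  It keeps the program, the simulated stacks and the
table of answers as association lists; changing an entry means adding a new pair in front, so that
its memory grows by a polynomially bounded amount in each step (`length_iterate_ustep_le`).
-/

namespace SearchProblems

open Polynomial

/-! ### Running and combining machines -/

/-- `Run O A s q n s' q'`: started in state `0` with stacks `s` after `q` queries, the machine `A`
with oracle `O` is halted after `n` steps, with stacks `s'` and query counter `q'`. -/
def Run (O : Str → Str) (A : Machine) (s : ℕ → Str) (q n : ℕ) (s' : ℕ → Str) (q' : ℕ) : Prop :=
  ∃ l, A.length ≤ l ∧ (step A O)^[n] ⟨0, s, q⟩ = ⟨l, s', q'⟩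

theorem step_of_halted {A : Machine} {O : Str → Str} {c : Config} (h : A.length ≤ c.state) :
    step A O c = c := by
  simp [step, List.getElem?_eq_none h]

theorem iterate_step_of_halted {A : Machine} {O : Str → Str} {c : Config}
    (h : A.length ≤ c.state) (n : ℕ) : (step A O)^[n] c = c :=
  Function.iterate_fixed (step_of_halted h) n

theorem iterate_step_of_le {A : Machine} {O : Str → Str} {c c' : Config} {m n : ℕ} (hmn : m ≤ n)
    (h : (step A O)^[m] c = c') (hc : A.length ≤ c'.state) : (step A O)^[n] c = c' := by
  obtain ⟨k, rfl⟩ := Nat.exists_eq_add_of_le' hmn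
  rw [Function.iterate_add_apply, h, iterate_step_of_halted hc]

theorem Run.mono {O : Str → Str} {A : Machine} {s s' : ℕ → Str} {q q' m n : ℕ}
    (h : Run O A s q m s' q') (hmn : m ≤ n) : Run O A s q n s' q' := by
  obtain ⟨l, hl, h⟩ := h
  exact ⟨l, hl, iterate_step_of_le hmn h hl⟩

/-- Replace every jump target `l` of an instruction by `φ l`. -/
def Instr.mapTarget (φ : ℕ → ℕ) : Instr → Instr
  | push r b l => push r b (φ l)
  | pop r l₀ l₁ lₑ => pop r (φ l₀) (φ l₁) (φ lₑ)
  | query l => query (φ l)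

/-- The state of a larger machine that corresponds to the state `l` of a machine with `len` states
placed at `off`, when halting is replaced by a jump to `exit`. -/
def target (off exit len l : ℕ) : ℕ := if l < len then off + l else exit

/-- The code of `A` made ready to be placed at `off` in a larger machine; instead of halting, it
jumps to `exit`. -/
def reloc (off exit : ℕ) (A : Machine) : Machine :=
  A.map (Instr.mapTarget (target off exit A.length))

@[simp] theorem length_reloc (off exit : ℕ) (A : Machine) :
    (reloc off exit A).length = A.length := by simp [reloc]

/-- `N` contains the relocated code of `A` at `off`. -/
def Contains (N : Machine) (off exit : ℕ) (A : Machine) : Prop :=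
  ∀ i < A.length, N[off + i]? = (reloc off exit A)[i]?

/-- In `N`, one gets from `c` to `c'` in at most `n` steps. -/
def Reach (N : Machine) (O : Str → Str) (c : Config) (n : ℕ) (c' : Config) : Prop :=
  ∃ m ≤ n, (step N O)^[m] c = c'

theorem Reach.trans {N : Machine} {O : Str → Str} {c c' c'' : Config} {m n : ℕ}
    (h : Reach N O c m c') (h' : Reach N O c' n c'') : Reach N O c (m + n) c'' := by
  obtain ⟨a, ha, rfl⟩ := h
  obtain ⟨b, hb, rfl⟩ := h'
  exact ⟨b + a, by omega, Function.iterate_add_apply ..⟩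

theorem Reach.head {N : Machine} {O : Str → Str} {c c' c'' : Config} {n : ℕ}
    (h : step N O c = c') (h' : Reach N O c' n c'') : Reach N O c (n + 1) c'' := by
  obtain ⟨b, hb, rfl⟩ := h'
  exact ⟨b + 1, by omega, by rw [Function.iterate_succ_apply, h]⟩

theorem Reach.run {N : Machine} {O : Str → Str} {s s' : ℕ → Str} {q q' n l : ℕ}
    (h : Reach N O ⟨0, s, q⟩ n ⟨l, s', q'⟩) (hl : N.length ≤ l) : Run O N s q n s' q' := by
  obtain ⟨m, hm, h⟩ := h
  exact ⟨l, hl, iterate_step_of_le hm h hl⟩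

/-- The larger machine simulates the relocated one step by step until the latter halts. -/
theorem step_of_contains {N A : Machine} {off exit : ℕ} (h : Contains N off exit A)
    (O : Str → Str) {c : Config} (hc : c.state < A.length) :
    step N O ⟨target off exit A.length c.state, c.stack, c.queries⟩ =
      ⟨target off exit A.length (step A O c).state, (step A O c).stack, (step A O c).queries⟩ := by
  have h1 : N[target off exit A.length c.state]? =
      some ((A[c.state]).mapTarget (target off exit A.length)) := by
    rw [target, if_pos hc, h _ hc]
    simp [reloc, hc]
  have h2 : A[c.state]? = some A[c.state] := List.getElem?_eq_getElem hc
  unfold step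
  simp only [h1, h2]
  rcases A[c.state] with ⟨r, b, l⟩ | ⟨r, l₀, l₁, lₑ⟩ | ⟨l⟩
  · simp [Instr.mapTarget]
  · simp only [Instr.mapTarget]
    rcases c.stack r with _ | ⟨b, s⟩
    · simp
    · cases b <;> simp
  · simp [Instr.mapTarget]

theorem reach_of_contains {N A : Machine} {off exit : ℕ} (h : Contains N off exit A)
    (O : Str → Str) (n : ℕ) (c : Config) (hc : A.length ≤ ((step A O)^[n] c).state) :
    Reach N O ⟨target off exit A.length c.state, c.stack, c.queries⟩ n
      ⟨exit, ((step A O)^[n] c).stack, ((step A O)^[n] c).queries⟩ := by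
  induction n generalizing c with
  | zero => exact ⟨0, le_rfl, by simp_all [target]⟩
  | succ n ih =>
    by_cases hs : c.state < A.length
    · exact Reach.head (step_of_contains h O hs) (ih _ hc)
    · rw [iterate_step_of_halted (not_lt.mp hs)]
      exact ⟨0, by omega, by simp [target, hs]⟩

/-- A run of `A` becomes a passage through the copy of `A` in the larger machine `N`. -/
theorem Run.reach {N A : Machine} {off exit : ℕ} (h : Contains N off exit A) {O : Str → Str}
    {s s' : ℕ → Str} {q q' n : ℕ} (hr : Run O A s q n s' q') :
    Reach N O ⟨target off exit A.length 0, s, q⟩ n ⟨exit, s', q'⟩ := by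
  obtain ⟨l, hl, hr⟩ := hr
  have := reach_of_contains h O n ⟨0, s, q⟩ (by rw [hr]; exact hl)
  rwa [hr] at this

theorem contains_of_append {N X A Y : Machine} {off exit : ℕ} (hN : N = X ++ reloc off exit A ++ Y)
    (hX : X.length = off) : Contains N off exit A := by
  intro i hi
  subst hN
  rw [List.append_assoc, List.getElem?_append_right (by omega),
    List.getElem?_append_left (by simp; omega)]
  congr 1
  omega

/-- Run `A`, then `B`. -/
def seq (A B : Machine) : Machine :=
  reloc 0 A.length A ++ reloc A.length (A.length + B.length) B

theorem Run.seq {O : Str → Str} {A B : Machine} {s s' s'' : ℕ → Str} {q q' q'' m n : ℕ}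
    (hA : Run O A s q m s' q') (hB : Run O B s' q' n s'' q'') :
    Run O (seq A B) s q (m + n) s'' q'' := by
  have h1 : Contains (SearchProblems.seq A B) 0 A.length A :=
    contains_of_append (X := []) (Y := reloc A.length (A.length + B.length) B) (by
      simp [SearchProblems.seq]) rfl
  have h2 : Contains (SearchProblems.seq A B) A.length (A.length + B.length) B :=
    contains_of_append (X := reloc 0 A.length A) (Y := []) (by simp [SearchProblems.seq]) (by simp)
  have e1 : target 0 A.length A.length 0 = 0 := by
    unfold target; split_ifs <;> omega
  have e2 : target A.length (A.length + B.length) B.length 0 = A.length := by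
    unfold target; split_ifs <;> omega
  have h3 := hA.reach h1
  have h4 := hB.reach h2
  rw [e1] at h3
  rw [e2] at h4
  exact (h3.trans h4).run (by simp [SearchProblems.seq])

/-- Pop the stack `r` and run `A₀`, `A₁` or `Aₑ`, depending on whether the bit found is `false`,
`true`, or the stack is empty.  In the first two cases, start again afterwards if `k₀` (`k₁`,
respectively) is `true`. -/
def popBranch (r : ℕ) (k₀ k₁ : Bool) (A₀ A₁ Aₑ : Machine) : Machine :=
  let len := 1 + A₀.length + A₁.length + Aₑ.length
  let exit (k : Bool) : ℕ := if k then 0 else len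
  [Instr.pop r (target 1 (exit k₀) A₀.length 0)
    (target (1 + A₀.length) (exit k₁) A₁.length 0)
    (target (1 + A₀.length + A₁.length) len Aₑ.length 0)] ++
  reloc 1 (exit k₀) A₀ ++ reloc (1 + A₀.length) (exit k₁) A₁ ++
  reloc (1 + A₀.length + A₁.length) len Aₑ

section popBranch

variable {O : Str → Str} {r : ℕ} {k₀ k₁ : Bool} {A₀ A₁ Aₑ : Machine} {s s' s'' : ℕ → Str}
  {q q' q'' m n : ℕ} {b : Bool} {w : Str}

theorem length_popBranch : (popBranch r k₀ k₁ A₀ A₁ Aₑ).length =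
    1 + A₀.length + A₁.length + Aₑ.length := by
  simp [popBranch]; omega

theorem Run.popBranch_nil (hs : s r = []) (h : Run O Aₑ s q n s' q') :
    Run O (popBranch r k₀ k₁ A₀ A₁ Aₑ) s q (n + 1) s' q' := by
  have h1 : Contains (popBranch r k₀ k₁ A₀ A₁ Aₑ) (1 + A₀.length + A₁.length)
      (1 + A₀.length + A₁.length + Aₑ.length) Aₑ :=
    contains_of_append (Y := []) (by rw [List.append_nil]; rfl) (by simp; omega)
  refine Reach.run (Reach.head ?_ (h.reach h1)) length_popBranch.le
  simp [step, popBranch, hs]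

/-- If the stack `r` is not empty, the chosen machine is run, followed by a jump to the start or to
the end. -/
theorem reach_popBranch_cons (hs : s r = b :: w)
    (h : Run O (bif b then A₁ else A₀) (Function.update s r w) q n s' q') :
    Reach (popBranch r k₀ k₁ A₀ A₁ Aₑ) O ⟨0, s, q⟩ (n + 1)
      ⟨if (bif b then k₁ else k₀) then 0 else 1 + A₀.length + A₁.length + Aₑ.length, s', q'⟩ := by
  cases b
  · have h1 : Contains (popBranch r k₀ k₁ A₀ A₁ Aₑ) 1
      (if k₀ then 0 else 1 + A₀.length + A₁.length + Aₑ.length) A₀ :=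
      contains_of_append (by simp only [popBranch, List.append_assoc]; rfl) (by simp)
    refine Reach.head ?_ (h.reach h1)
    simp [step, popBranch, hs]
  · have h1 : Contains (popBranch r k₀ k₁ A₀ A₁ Aₑ) (1 + A₀.length)
      (if k₁ then 0 else 1 + A₀.length + A₁.length + Aₑ.length) A₁ :=
      contains_of_append rfl (by simp; omega)
    refine Reach.head ?_ (h.reach h1)
    simp [step, popBranch, hs]

theorem Run.popBranch_exit (hs : s r = b :: w) (hk : (bif b then k₁ else k₀) = false)
    (h : Run O (bif b then A₁ else A₀) (Function.update s r w) q n s' q') :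
    Run O (popBranch r k₀ k₁ A₀ A₁ Aₑ) s q (n + 1) s' q' := by
  have := reach_popBranch_cons (k₀ := k₀) (k₁ := k₁) (Aₑ := Aₑ) hs h
  rw [hk] at this
  exact this.run (by simp [length_popBranch])

theorem Run.popBranch_loop (hs : s r = b :: w) (hk : (bif b then k₁ else k₀) = true)
    (h : Run O (bif b then A₁ else A₀) (Function.update s r w) q n s' q')
    (h' : Run O (popBranch r k₀ k₁ A₀ A₁ Aₑ) s' q' m s'' q'') :
    Run O (popBranch r k₀ k₁ A₀ A₁ Aₑ) s q (n + 1 + m) s'' q'' := by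
  have h1 := reach_popBranch_cons (k₀ := k₀) (k₁ := k₁) (Aₑ := Aₑ) hs h
  rw [hk] at h1
  obtain ⟨l, hl, h2⟩ := h'
  exact (h1.trans ⟨m, le_rfl, h2⟩).run hl

end popBranch

/-! ### Machines without queries -/

theorem queryFree_nil : Machine.QueryFree [] := by simp [Machine.QueryFree]

theorem queryFree_append {A B : Machine} (hA : A.QueryFree) (hB : B.QueryFree) :
    Machine.QueryFree (A ++ B) := fun l h => by
  rcases List.mem_append.mp h with h | h
  exacts [hA l h, hB l h]

theorem queryFree_reloc {A : Machine} (hA : A.QueryFree) (off exit : ℕ) :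
    (reloc off exit A).QueryFree := by
  intro l h
  obtain ⟨i, hi, h⟩ := List.mem_map.mp h
  cases i <;> simp [Instr.mapTarget] at h
  exact hA _ hi

theorem queryFree_seq {A B : Machine} (hA : A.QueryFree) (hB : B.QueryFree) :
    (seq A B).QueryFree :=
  queryFree_append (queryFree_reloc hA _ _) (queryFree_reloc hB _ _)

theorem queryFree_popBranch {r : ℕ} {k₀ k₁ : Bool} {A₀ A₁ Aₑ : Machine} (h₀ : A₀.QueryFree)
    (h₁ : A₁.QueryFree) (hₑ : Aₑ.QueryFree) : (popBranch r k₀ k₁ A₀ A₁ Aₑ).QueryFree :=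
  queryFree_append (queryFree_append (queryFree_append (by simp [Machine.QueryFree])
    (queryFree_reloc h₀ _ _)) (queryFree_reloc h₁ _ _)) (queryFree_reloc hₑ _ _)

/-- With every oracle, `A` takes the stacks `s` to the stacks `s'` in at most `n` steps, without
changing the number of queries. -/
def Computes (A : Machine) (s : ℕ → Str) (n : ℕ) (s' : ℕ → Str) : Prop :=
  ∀ (O : Str → Str) (q : ℕ), Run O A s q n s' q

theorem Computes.mono {A : Machine} {s s' : ℕ → Str} {m n : ℕ} (h : Computes A s m s')
    (hmn : m ≤ n) : Computes A s n s' := fun O q => (h O q).mono hmn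

theorem Computes.seq {A B : Machine} {s s' s'' : ℕ → Str} {m n : ℕ}
    (hA : Computes A s m s') (hB : Computes B s' n s'') : Computes (seq A B) s (m + n) s'' :=
  fun O q => (hA O q).seq (hB O q)

theorem computes_nil (s : ℕ → Str) : Computes [] s 0 s := fun _ _ => ⟨0, le_rfl, rfl⟩

theorem computes_push (r : ℕ) (b : Bool) (s : ℕ → Str) :
    Computes [Instr.push r b 1] s 1 (Function.update s r (b :: s r)) :=
  fun _ _ => ⟨1, le_rfl, rfl⟩

/-- For a query-free machine, the oracle and the query counter play no role. -/
theorem iterate_step_queryFree {A : Machine} (hA : A.QueryFree) (O O' : Str → Str) (n : ℕ) :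
    ∀ (c : Config) (q : ℕ), (step A O)^[n] { c with queries := q } =
      { (step A O')^[n] c with queries := q } := by
  have key : ∀ (c : Config) (q : ℕ),
      step A O { c with queries := q } = { step A O' c with queries := q } := by
    intro c q
    unfold step
    rcases h : A[c.state]? with _ | i
    · rfl
    · rcases i with ⟨r, b, l⟩ | ⟨r, l₀, l₁, lₑ⟩ | ⟨l⟩
      · rfl
      · rcases h' : c.stack r with _ | ⟨b, w⟩ <;> simp [h']
      · exact absurd (List.mem_of_getElem? h) (hA l)
  induction n with
  | zero => intro c q; rfl
  | succ n ih => intro c q; rw [Function.iterate_succ_apply, key, ih, Function.iterate_succ_apply]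

theorem length_stack_step {A : Machine} (hA : A.QueryFree) (O : Str → Str) (c : Config) (r : ℕ) :
    ((step A O c).stack r).length ≤ (c.stack r).length + 1 := by
  unfold step
  rcases h : A[c.state]? with _ | i
  · simp
  · rcases i with ⟨r', b, l⟩ | ⟨r', l₀, l₁, lₑ⟩ | ⟨l⟩
    · by_cases hr : r = r' <;> simp [hr]
    · rcases h' : c.stack r' with _ | ⟨b, w⟩
      · simp [h']
      · by_cases hr : r = r'
        · subst hr; simp [h']; omega
        · simp [hr, h']
    · exact absurd (List.mem_of_getElem? h) (hA l)

theorem length_stack_iterate {A : Machine} (hA : A.QueryFree) (O : Str → Str) (n : ℕ)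
    (c : Config) (r : ℕ) :
    (((step A O)^[n] c).stack r).length ≤ (c.stack r).length + n := by
  induction n generalizing c with
  | zero => simp
  | succ n ih =>
    have := ih (step A O c)
    have := length_stack_step hA O c r
    rw [Function.iterate_succ_apply]
    omega

theorem Computes.length_le {A : Machine} (hA : A.QueryFree) {s s' : ℕ → Str} {n : ℕ}
    (h : Computes A s n s') (r : ℕ) : (s' r).length ≤ (s r).length + n := by
  obtain ⟨l, -, h⟩ := h (fun _ => []) 0
  have := length_stack_iterate hA (fun _ => []) n ⟨0, s, 0⟩ r
  rwa [h] at this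

/-! ### Renaming the stacks -/

/-- Replace every stack number `r` by `σ r` (harmless only for instructions that are not
queries). -/
def Instr.mapStack (σ : ℕ → ℕ) : Instr → Instr
  | push r b l => push (σ r) b l
  | pop r l₀ l₁ lₑ => pop (σ r) l₀ l₁ lₑ
  | query l => query l

/-- The machine `A` with its stacks renamed by `σ`. -/
def Machine.rename (σ : ℕ → ℕ) (A : Machine) : Machine := A.map (Instr.mapStack σ)

theorem queryFree_rename {A : Machine} (hA : A.QueryFree) (σ : ℕ → ℕ) :
    (Machine.rename σ A).QueryFree := by
  intro l h
  obtain ⟨i, hi, h⟩ := List.mem_map.mp h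
  cases i <;> simp [Instr.mapStack] at h
  exact hA _ (h ▸ hi)

/-- A machine with renamed stacks does the same on the renamed stacks and leaves the other ones
alone. -/
theorem Computes.rename {A : Machine} (hA : A.QueryFree) {σ : ℕ → ℕ} (hσ : σ.Injective)
    {a a' s s' : ℕ → Str} {n : ℕ} (h : Computes A a n a') (hs : ∀ r, s (σ r) = a r)
    (hs' : ∀ r, s' (σ r) = a' r) (hf : ∀ r, r ∉ Set.range σ → s' r = s r) :
    Computes (Machine.rename σ A) s n s' := by
  intro O q
  have key : ∀ (n : ℕ) (c d : Config), c.state = d.state → c.queries = d.queries →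
      (∀ r, d.stack (σ r) = c.stack r) → (∀ r, r ∉ Set.range σ → d.stack r = s r) →
      ∃ d' : Config, (step (Machine.rename σ A) O)^[n] d = d' ∧
        ((step A O)^[n] c).state = d'.state ∧ ((step A O)^[n] c).queries = d'.queries ∧
        (∀ r, d'.stack (σ r) = ((step A O)^[n] c).stack r) ∧
        (∀ r, r ∉ Set.range σ → d'.stack r = s r) := by
    intro n
    induction n with
    | zero => intro c d h1 h2 h3 h4; exact ⟨d, rfl, h1, h2, h3, h4⟩
    | succ n ih =>
      intro c d h1 h2 h3 h4
      simp only [Function.iterate_succ_apply]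
      have hi : (Machine.rename σ A)[d.state]? = A[c.state]?.map (Instr.mapStack σ) := by
        rw [Machine.rename, List.getElem?_map, h1]
      unfold step
      rw [hi]
      rcases h : A[c.state]? with _ | i
      · exact ih _ _ h1 h2 h3 h4
      · rcases i with ⟨r', b, l⟩ | ⟨r', l₀, l₁, lₑ⟩ | ⟨l⟩
        · simp only [Option.map_some, Instr.mapStack, h3]
          refine ih _ _ rfl h2 (fun r => ?_) (fun r hr => ?_)
          · by_cases hr : r = r'
            · simp [hr]
            · simp [hσ.eq_iff, hr, h3]
          · have : r ≠ σ r' := fun h => hr ⟨r', h.symm⟩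
            simp [this, h4 r hr]
        · simp only [Option.map_some, Instr.mapStack, h3]
          rcases h' : c.stack r' with _ | ⟨b, w⟩
          · exact ih _ _ rfl h2 h3 h4
          · refine ih _ _ rfl h2 (fun r => ?_) (fun r hr => ?_)
            · by_cases hr : r = r'
              · simp [hr]
              · simp [hσ.eq_iff, hr, h3]
            · have : r ≠ σ r' := fun h => hr ⟨r', h.symm⟩
              simp [this, h4 r hr]
        · exact absurd (List.mem_of_getElem? h) (hA l)
  obtain ⟨l, hl, h⟩ := h O q
  obtain ⟨d', h0, h1, h2, h3, h4⟩ := key n ⟨0, a, q⟩ ⟨0, s, q⟩ rfl rfl hs (fun _ _ => rfl)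
  rw [h] at h1 h2 h3
  refine ⟨d'.state, by rw [← h1]; simpa [Machine.rename] using hl, ?_⟩
  have : d'.stack = s' := by
    funext r
    by_cases hr : r ∈ Set.range σ
    · obtain ⟨r, rfl⟩ := hr
      rw [h3, hs']
    · rw [h4 r hr, hf r hr]
  rw [h0, ← this]
  dsimp at h2
  rw [h2]

/-! ### Pairs of strings and polynomial bounds -/

/-- The pair of the strings `u` and `v`: each bit of `u` is preceded by `true`, and `false`
separates `u` from `v`. -/
def pair : Str → Str → Str
  | [], v => false :: v
  | b :: u, v => true :: b :: pair u v

/-- The first component of a pair; a total function on strings. -/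
def car : Str → Str
  | true :: b :: w => b :: car w
  | _ => []

/-- The second component of a pair; a total function on strings. On no string are the components
longer than the string, see `length_car_add_length_cdr`. -/
def cdr : Str → Str
  | true :: _ :: w => cdr w
  | false :: w => w
  | _ => []

@[simp] theorem car_nil : car [] = [] := rfl

@[simp] theorem cdr_nil : cdr [] = [] := rfl

@[simp] theorem car_pair (u v : Str) : car (pair u v) = u := by
  induction u with
  | nil => rfl
  | cons b u ih => simp [pair, car, ih]

@[simp] theorem cdr_pair (u v : Str) : cdr (pair u v) = v := by
  induction u with
  | nil => rfl
  | cons b u ih => simp [pair, cdr, ih]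

@[simp] theorem length_pair (u v : Str) : (pair u v).length = 2 * u.length + 1 + v.length := by
  induction u with
  | nil => simp [pair]; omega
  | cons b u ih => simp [pair, ih]; omega

theorem length_car_add_length_cdr (w : Str) : 2 * (car w).length + (cdr w).length ≤ w.length := by
  fun_induction car w with
  | case1 b w ih => simp [cdr]; omega
  | case2 w h =>
    rcases w with _ | ⟨_ | _, _ | _⟩ <;> simp_all [cdr]

theorem length_car_le (w : Str) : (car w).length ≤ w.length := by
  have := length_car_add_length_cdr w; omega

theorem length_cdr_le (w : Str) : (cdr w).length ≤ w.length := by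
  have := length_car_add_length_cdr w; omega

/-- `F x` is bounded by a polynomial in `|x|`. -/
def PolyBounded (F : Str → ℕ) : Prop := ∃ b : ℕ[X], ∀ x, F x ≤ b.eval x.length

theorem eval_le_eval (p : ℕ[X]) {m n : ℕ} (h : m ≤ n) : p.eval m ≤ p.eval n := by
  simp only [Polynomial.eval_eq_sum, Polynomial.sum]
  gcongr

namespace PolyBounded

variable {F G : Str → ℕ}

theorem mono (hG : PolyBounded G) (h : ∀ x, F x ≤ G x) : PolyBounded F :=
  let ⟨b, hb⟩ := hG; ⟨b, fun x => (h x).trans (hb x)⟩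

theorem const (k : ℕ) : PolyBounded fun _ => k := ⟨C k, fun x => by simp⟩

theorem length : PolyBounded fun x => x.length := ⟨X, fun x => by simp⟩

theorem add (hF : PolyBounded F) (hG : PolyBounded G) : PolyBounded fun x => F x + G x := by
  obtain ⟨b, hb⟩ := hF
  obtain ⟨c, hc⟩ := hG
  exact ⟨b + c, fun x => by rw [eval_add]; exact add_le_add (hb x) (hc x)⟩

theorem mul (hF : PolyBounded F) (hG : PolyBounded G) : PolyBounded fun x => F x * G x := by
  obtain ⟨b, hb⟩ := hF
  obtain ⟨c, hc⟩ := hG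
  exact ⟨b * c, fun x => by rw [eval_mul]; exact Nat.mul_le_mul (hb x) (hc x)⟩

theorem eval (p : ℕ[X]) (hF : PolyBounded F) : PolyBounded fun x => p.eval (F x) := by
  obtain ⟨b, hb⟩ := hF
  exact ⟨p.comp b, fun x => by rw [eval_comp]; exact eval_le_eval p (hb x)⟩

end PolyBounded

/-! ### Loops over a stack -/

/-- The stacks `0, 1, …` contain the strings in the list, all the other ones are empty. -/
def store (l : List Str) : ℕ → Str := fun r => l.getD r []

/-- Empty the stack `a`, running `A₀` or `A₁` for each bit. -/
def forEach (a : ℕ) (A₀ A₁ : Machine) : Machine := popBranch a true true A₀ A₁ []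

theorem queryFree_forEach {a : ℕ} {A₀ A₁ : Machine} (h₀ : A₀.QueryFree) (h₁ : A₁.QueryFree) :
    (forEach a A₀ A₁).QueryFree := queryFree_popBranch h₀ h₁ queryFree_nil

/-- The loop rule: `S u w` are the stacks when the bits `u` (the last one first) have been treated
and `w` is still on the stack `a`. -/
theorem computes_forEach {a : ℕ} {A₀ A₁ : Machine} (S : Str → Str → ℕ → Str) (k : ℕ) (w : Str)
    (hS : ∀ u w, S u w a = w)
    (h : ∀ u b v, u.length + v.length < w.length →
      Computes (bif b then A₁ else A₀) (Function.update (S u (b :: v)) a v) k (S (b :: u) v)) :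
    Computes (forEach a A₀ A₁) (S [] w) ((k + 1) * w.length + 1) (S w.reverse []) := by
  have key : ∀ v u : Str, u.length + v.length = w.length →
      Computes (forEach a A₀ A₁) (S u v) ((k + 1) * v.length + 1) (S (v.reverse ++ u) []) := by
    intro v
    induction v with
    | nil => intro u _ O q; simpa [forEach] using Run.popBranch_nil (hS u []) (computes_nil _ O q)
    | cons b v ih =>
      intro u hu O q
      simp only [List.length_cons] at hu ⊢
      have h2 := ih (b :: u) (by simp; omega) O q
      have := Run.popBranch_loop (k₀ := true) (k₁ := true) (Aₑ := []) (hS u (b :: v))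
        (by cases b <;> rfl) (h u b v (by omega) O q) h2
      rw [List.reverse_cons, List.append_assoc]
      exact this.mono (by rw [Nat.mul_succ]; omega)
  simpa using key w [] (by simp)

/-- Empty the stack `a`. -/
def clear (a : ℕ) : Machine := forEach a [] []

theorem computes_clear (a : ℕ) (s : ℕ → Str) :
    Computes (clear a) s ((s a).length + 1) (Function.update s a []) := by
  have := computes_forEach (a := a) (A₀ := []) (A₁ := [])
    (fun _ w => Function.update s a w) 0 (s a) (by simp)
    (fun u b v _ => by simpa using computes_nil _)
  simpa [clear] using this

/-- Pour the stack `a` onto the stack `b`. -/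
def move (a b : ℕ) : Machine := forEach a [Instr.push b false 1] [Instr.push b true 1]

theorem computes_move {a b : ℕ} (hab : a ≠ b) (s : ℕ → Str) :
    Computes (move a b) s (2 * (s a).length + 1)
      (Function.update (Function.update s a []) b ((s a).reverse ++ s b)) := by
  have := computes_forEach (a := a) (A₀ := [Instr.push b false 1]) (A₁ := [Instr.push b true 1])
    (fun u w => Function.update (Function.update s a w) b (u ++ s b)) 1 (s a) (by simp [hab])
    (fun u x v _ => by
      convert computes_push b x _ using 1
      · cases x <;> rfl
      · funext r
        by_cases h : r = b
        · simp [h, hab.symm]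
        · by_cases h' : r = a <;> simp [h, h', hab])
  simpa [move] using this

theorem queryFree_push {r : ℕ} {b : Bool} {l : ℕ} : Machine.QueryFree [Instr.push r b l] := by
  simp [Machine.QueryFree]

theorem queryFree_clear {a : ℕ} : (clear a).QueryFree :=
  queryFree_forEach queryFree_nil queryFree_nil

theorem queryFree_move {a b : ℕ} : (move a b).QueryFree :=
  queryFree_forEach queryFree_push queryFree_push

theorem computes_move_store {a b : ℕ} (hab : a ≠ b) {s s' : List Str}
    (h : Function.update (Function.update (store s) a []) b ((store s a).reverse ++ store s b) =
      store s') : Computes (move a b) (store s) (2 * (store s a).length + 1) (store s') :=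
  h ▸ computes_move hab _

/-- Copy the contents of stack `0` to stack `1`. -/
def dup : Machine :=
  seq (move 0 2) (forEach 2 (seq [Instr.push 0 false 1] [Instr.push 1 false 1])
    (seq [Instr.push 0 true 1] [Instr.push 1 true 1]))

theorem queryFree_dup : dup.QueryFree :=
  queryFree_seq queryFree_move (queryFree_forEach
    (queryFree_seq queryFree_push queryFree_push)
    (queryFree_seq queryFree_push queryFree_push))

theorem computes_dup (x : Str) :
    Computes dup (store [x]) (5 * x.length + 2) (store [x, x]) := by
  have h1 := computes_move_store (a := 0) (b := 2) (by simp) (s := [x])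
    (s' := [[], [], x.reverse])
    (by funext r; rcases r with _ | _ | _ | r <;> simp [store])
  have h2 := computes_forEach (a := 2) (A₀ := seq [Instr.push 0 false 1] [Instr.push 1 false 1])
    (A₁ := seq [Instr.push 0 true 1] [Instr.push 1 true 1])
    (fun u w => store [u, u, w]) 2 x.reverse (by simp [store])
    (fun u b v _ => by
      convert (computes_push 0 b _).seq (computes_push 1 b _) using 1
      · cases b <;> rfl
      · funext r; rcases r with _ | _ | _ | r <;> simp [store])
  have := h1.seq h2
  simp only [List.reverse_reverse, List.length_reverse] at this
  have e : store [x, x, []] = store [x, x] := by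
    funext r; rcases r with _ | _ | _ | r <;> simp [store]
  rw [e] at this
  exact this.mono (by simp [store]; omega)

/-- Replace the contents `u` and `v` of the stacks `0` and `1` by `pair u v` on stack `0`. -/
def pack : Machine :=
  seq (move 0 2) <| seq [Instr.push 1 false 1] <|
    seq (forEach 2 (seq [Instr.push 1 false 1] [Instr.push 1 true 1])
      (seq [Instr.push 1 true 1] [Instr.push 1 true 1])) <| seq (move 1 2) (move 2 0)

theorem queryFree_pack : pack.QueryFree :=
  queryFree_seq queryFree_move <| queryFree_seq queryFree_push <| queryFree_seq
    (queryFree_forEach (queryFree_seq queryFree_push queryFree_push)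
      (queryFree_seq queryFree_push queryFree_push)) <|
    queryFree_seq queryFree_move queryFree_move

theorem computes_pack (u v : Str) :
    Computes pack (store [u, v]) (13 * u.length + 4 * v.length + 9) (store [pair u v]) := by
  have h1 := computes_move_store (a := 0) (b := 2) (by simp) (s := [u, v])
    (s' := [[], v, u.reverse])
    (by funext r; rcases r with _ | _ | _ | r <;> simp [store])
  have h2 := computes_push 1 false (store [[], v, u.reverse])
  have e2 : Function.update (store [[], v, u.reverse]) 1
      (false :: store [[], v, u.reverse] 1) = store [[], pair [] v, u.reverse] := by
    funext r; rcases r with _ | _ | _ | r <;> simp [store, pair]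
  rw [e2] at h2
  have h3 := computes_forEach (a := 2) (A₀ := seq [Instr.push 1 false 1] [Instr.push 1 true 1])
    (A₁ := seq [Instr.push 1 true 1] [Instr.push 1 true 1])
    (fun z w => store [[], pair z v, w]) 2 u.reverse (by simp [store])
    (fun z b w _ => by
      convert (computes_push 1 b _).seq (computes_push 1 true _) using 1
      · cases b <;> rfl
      · funext r; rcases r with _ | _ | _ | r <;> simp [store, pair])
  rw [List.reverse_reverse] at h3
  have h4 := computes_move_store (a := 1) (b := 2) (by simp) (s := [[], pair u v, []])
    (s' := [[], [], (pair u v).reverse])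
    (by funext r; rcases r with _ | _ | _ | r <;> simp [store])
  have h5 := computes_move_store (a := 2) (b := 0) (by simp) (s := [[], [], (pair u v).reverse])
    (s' := [pair u v])
    (by funext r; rcases r with _ | _ | _ | r <;> simp [store])
  exact (h1.seq (h2.seq (h3.seq (h4.seq h5)))).mono (by simp [store]; omega)

/-- The loop of `unpack`: take the first component off the stack `0` and put it, reversed, on the
stack `2`. -/
def unpackLoop : Machine :=
  popBranch 0 false true []
    (popBranch 0 false false [Instr.push 2 false 1] [Instr.push 2 true 1] []) []

theorem computes_unpackLoop (w u : Str) :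
    Computes unpackLoop (store [w, [], u]) (3 * w.length + 3)
      (store [cdr w, [], (car w).reverse ++ u]) := by
  fun_induction car w generalizing u with
  | case1 b w ih =>
    intro O q
    have h1 : Run O (popBranch 0 false false [Instr.push 2 false 1] [Instr.push 2 true 1] [])
        (store [b :: w, [], u]) q 2 (store [w, [], b :: u]) q := by
      refine Run.popBranch_exit (b := b) (w := w) rfl (by cases b <;> rfl) ?_
      convert computes_push 2 b _ O q using 1
      · cases b <;> rfl
      · funext r; rcases r with _ | _ | _ | r <;> simp [store]
    have h2 : Function.update (store [true :: b :: w, [], u]) 0 (b :: w) =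
        store [b :: w, [], u] := by
      funext r; rcases r with _ | _ | _ | r <;> simp [store]
    have h3 := Run.popBranch_loop (O := O) (r := 0) (k₀ := false) (k₁ := true) (A₀ := [])
      (Aₑ := []) (s := store [true :: b :: w, [], u]) (b := true) (w := b :: w) rfl rfl
      (by rw [h2]; exact h1) (ih (b :: u) O q)
    simpa [cdr, unpackLoop] using h3.mono (n := 3 * (true :: b :: w).length + 3) (by simp; omega)
  | case2 w h =>
    intro O q
    rcases w with _ | ⟨_ | _, w⟩
    · exact (Run.popBranch_nil rfl (computes_nil _ O q)).mono (by omega)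
    · refine Run.mono (Run.popBranch_exit (b := false) (w := w) rfl rfl (?_ : Run O [] _ q 0 _ q))
        (by omega)
      convert computes_nil _ O q using 1
      funext r; rcases r with _ | _ | _ | r <;> simp [store, cdr]
    · rcases w with _ | ⟨b, w⟩
      · refine Run.mono (Run.popBranch_loop (b := true) (w := []) rfl rfl
          (Run.popBranch_nil (by simp) (computes_nil _ O q))
          (Run.popBranch_nil (by simp) (?_ : Run O [] _ q 0 _ q)))
          (by simp)
        convert computes_nil _ O q using 1
        funext r; rcases r with _ | _ | _ | r <;> simp [store, cdr]
      · exact absurd rfl (h b w)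

/-- Replace the contents `w` of stack `0` by its components, on the stacks `0` and `1`. -/
def unpack : Machine :=
  seq unpackLoop <| seq (move 0 3) <| seq (move 3 1) (move 2 0)

theorem queryFree_unpack : unpack.QueryFree :=
  queryFree_seq (queryFree_popBranch queryFree_nil (queryFree_popBranch queryFree_push
    queryFree_push queryFree_nil) queryFree_nil) <| queryFree_seq queryFree_move <|
    queryFree_seq queryFree_move queryFree_move

theorem computes_unpack (w : Str) :
    Computes unpack (store [w]) (9 * w.length + 6) (store [car w, cdr w]) := by
  have h1 := computes_unpackLoop w []
  have h2 := computes_move_store (a := 0) (b := 3) (by simp)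
    (s := [cdr w, [], (car w).reverse ++ []]) (s' := [[], [], (car w).reverse, (cdr w).reverse])
    (by funext r; rcases r with _ | _ | _ | _ | r <;> simp [store])
  have h3 := computes_move_store (a := 3) (b := 1) (by simp)
    (s := [[], [], (car w).reverse, (cdr w).reverse]) (s' := [[], cdr w, (car w).reverse])
    (by funext r; rcases r with _ | _ | _ | _ | r <;> simp [store])
  have h4 := computes_move_store (a := 2) (b := 0) (by simp)
    (s := [[], cdr w, (car w).reverse]) (s' := [car w, cdr w])
    (by funext r; rcases r with _ | _ | _ | _ | r <;> simp [store])
  have e : store [w, [], []] = store [w] := by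
    funext r; rcases r with _ | _ | _ | r <;> simp [store]
  rw [e] at h1
  have := length_car_add_length_cdr w
  exact (h1.seq (h2.seq (h3.seq h4))).mono (by simp [store]; omega)

/-! ### Functions computable in polynomial time -/

/-- The function `f` on strings is computable in polynomial time by a query-free machine that
leaves all stacks but stack `0` empty. -/
def PolyTime (f : Str → Str) : Prop :=
  ∃ A : Machine, A.QueryFree ∧ ∃ t : ℕ[X], ∀ x, Computes A (store [x]) (t.eval x.length)
    (store [f x])

theorem PolyTime.intro {f : Str → Str} {A : Machine} (hA : A.QueryFree) {T : Str → ℕ}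
    (hT : PolyBounded T) (h : ∀ x, Computes A (store [x]) (T x) (store [f x])) : PolyTime f :=
  let ⟨t, ht⟩ := hT; ⟨A, hA, t, fun x => (h x).mono (ht x)⟩

theorem PolyTime.length {f : Str → Str} (hf : PolyTime f) : PolyBounded fun x => (f x).length := by
  obtain ⟨A, hA, t, h⟩ := hf
  refine ⟨X + t, fun x => ?_⟩
  simpa [store] using (h x).length_le hA 0

/-- Interleave two families of stacks, to run a machine on one family while keeping the other. -/
def interleave (a b : ℕ → Str) : ℕ → Str := fun r => if r % 2 = 0 then a (r / 2) else b (r / 2)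

theorem Computes.even {A : Machine} (hA : A.QueryFree) {a a' : ℕ → Str} {n : ℕ}
    (h : Computes A a n a') (b : ℕ → Str) :
    Computes (Machine.rename (fun r => 2 * r) A) (interleave a b) n (interleave a' b) := by
  refine h.rename hA (fun r r' h => by simpa using h) (fun r => ?_) (fun r => ?_) (fun r hr => ?_)
  · simp [interleave]
  · simp [interleave]
  · have : r % 2 ≠ 0 := fun h => hr ⟨r / 2, by dsimp only; omega⟩
    simp [interleave, this]

theorem Computes.odd {A : Machine} (hA : A.QueryFree) {b b' : ℕ → Str} {n : ℕ}
    (h : Computes A b n b') (a : ℕ → Str) :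
    Computes (Machine.rename (fun r => 2 * r + 1) A) (interleave a b) n (interleave a b') := by
  refine h.rename hA (fun r r' h => by simpa using h) (fun r => ?_) (fun r => ?_) (fun r hr => ?_)
  · have : (2 * r + 1) / 2 = r := by omega
    simp [interleave, this, Nat.add_mod]
  · have : (2 * r + 1) / 2 = r := by omega
    simp [interleave, this, Nat.add_mod]
  · have : r % 2 = 0 := by
      by_contra h
      exact hr ⟨r / 2, by dsimp only; omega⟩
    simp [interleave, this]

theorem interleave_store (u v : Str) : interleave (store [u]) (store [v]) = store [u, v] := by
  funext r
  rcases r with _ | _ | r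
  · simp [interleave, store]
  · simp [interleave, store]
  · have : (r + 1 + 1) / 2 = r / 2 + 1 := by omega
    simp [interleave, store, this]

namespace PolyTime

variable {f g h n f₀ f₁ fₑ : Str → Str}

theorem id : PolyTime fun x => x :=
  .intro queryFree_nil (.const 0) fun _ => computes_nil _

theorem comp (hf : PolyTime f) (hg : PolyTime g) : PolyTime fun x => f (g x) := by
  have hl := hg.length
  obtain ⟨A, hA, t, hA'⟩ := hf
  obtain ⟨B, hB, u, hB'⟩ := hg
  exact .intro (queryFree_seq hB hA) ((PolyBounded.length.eval u).add (hl.eval t))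
    fun x => (hB' x).seq (hA' _)

theorem cons (b : Bool) (hf : PolyTime f) : PolyTime fun x => b :: f x := by
  refine comp (f := fun x => b :: x) (.intro (A := [Instr.push 0 b 1]) queryFree_push (.const 1)
    fun x => ?_) hf
  convert computes_push 0 b _ using 1
  funext r; rcases r with _ | r <;> simp [store]

theorem tail (hf : PolyTime f) : PolyTime fun x => (f x).tail := by
  refine comp (f := List.tail) (.intro (A := popBranch 0 false false [] [] [])
    (queryFree_popBranch queryFree_nil queryFree_nil queryFree_nil) (.const 1) fun x O q => ?_) hf
  rcases x with _ | ⟨b, x⟩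
  · exact Run.popBranch_nil rfl (computes_nil _ O q)
  · refine Run.popBranch_exit rfl (by cases b <;> rfl) (?_ : Run O _ _ q 0 _ q)
    convert computes_nil _ O q using 1
    · cases b <;> rfl
    · funext r; rcases r with _ | r <;> simp [store]

theorem const (u : Str) : PolyTime fun _ => u := by
  induction u with
  | nil =>
    refine .intro (queryFree_clear (a := 0)) (T := fun x => x.length + 1) (.add .length (.const 1))
      fun x => ?_
    convert computes_clear 0 (store [x]) using 1
    · rfl
    · funext r; rcases r with _ | r <;> simp [store]
  | cons b u ih => exact ih.cons b

theorem pair (hf : PolyTime f) (hg : PolyTime g) : PolyTime fun x => pair (f x) (g x) := by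
  have hfl := hf.length
  have hgl := hg.length
  obtain ⟨A, hA, t, hA'⟩ := hf
  obtain ⟨B, hB, u, hB'⟩ := hg
  refine .intro (queryFree_seq queryFree_dup <|
      queryFree_seq (queryFree_rename hA fun r => 2 * r) <|
      queryFree_seq (queryFree_rename hB fun r => 2 * r + 1) queryFree_pack)
    (T := fun x => (5 * x.length + 2) + (t.eval x.length + (u.eval x.length +
      (13 * (f x).length + 4 * (g x).length + 9)))) ?_ fun x => ?_
  · exact .add (.add (.mul (.const 5) .length) (.const 2)) <| .add (.eval t .length) <|
      .add (.eval u .length) (.add (.add (.mul (.const 13) hfl) (.mul (.const 4) hgl)) (.const 9))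
  · have h1 := (hA' x).even hA (store [x])
    have h2 := (hB' x).odd hB (store [f x])
    rw [interleave_store, interleave_store] at h1 h2
    exact (computes_dup x).seq <| h1.seq <| h2.seq <| computes_pack (f x) (g x)

/-- Two functions can be computed simultaneously, their values on the stacks `0` and `1`. -/
theorem exists_machine_two (hf : PolyTime f) (hg : PolyTime g) :
    ∃ A : Machine, A.QueryFree ∧ ∃ T, PolyBounded T ∧
      ∀ x, Computes A (store [x]) (T x) (store [f x, g x]) := by
  have hfg := (hf.pair hg).length
  obtain ⟨A, hA, t, h⟩ := hf.pair hg
  refine ⟨_, queryFree_seq hA queryFree_unpack, _, .add (.eval t .length)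
    (.add (.mul (.const 9) hfg) (.const 6)), fun x => (h x).seq ?_⟩
  simpa using computes_unpack (SearchProblems.pair (f x) (g x))

end PolyTime

/-- Move the contents of stack `1` to stack `0`. -/
def moveHome : Machine := seq (move 1 2) (move 2 0)

theorem queryFree_moveHome : moveHome.QueryFree := queryFree_seq queryFree_move queryFree_move

theorem computes_moveHome (v : Str) :
    Computes moveHome (store [[], v]) (4 * v.length + 2) (store [v]) := by
  have h1 := computes_move_store (a := 1) (b := 2) (by simp) (s := [[], v])
    (s' := [[], [], v.reverse])
    (by funext r; rcases r with _ | _ | _ | r <;> simp [store])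
  have h2 := computes_move_store (a := 2) (b := 0) (by simp) (s := [[], [], v.reverse])
    (s' := [v])
    (by funext r; rcases r with _ | _ | _ | r <;> simp [store])
  exact (h1.seq h2).mono (by simp [store]; omega)

theorem computes_clear_zero (u v : Str) :
    Computes (clear 0) (store [u, v]) (u.length + 1) (store [[], v]) := by
  convert computes_clear 0 (store [u, v]) using 1
  · rfl
  · funext r; rcases r with _ | _ | r <;> simp [store]

/-- Branching on the first bit of the string `w`: the value is `uₑ` if `w` is empty, `u₀` if `w`
starts with `false`, and `u₁` if it starts with `true`. -/
def branch (w uₑ u₀ u₁ : Str) : Str :=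
  match w with
  | [] => uₑ
  | false :: _ => u₀
  | true :: _ => u₁

namespace PolyTime

variable {f g h n f₀ f₁ fₑ : Str → Str}

theorem car (hf : PolyTime f) : PolyTime fun x => car (f x) := by
  refine comp (f := SearchProblems.car) (.intro (queryFree_seq queryFree_unpack
    (queryFree_clear (a := 1))) (T := fun x => 9 * x.length + 6 + (x.length + 1)) ?_ fun x => ?_) hf
  · exact .add (.add (.mul (.const 9) .length) (.const 6)) (.add .length (.const 1))
  · refine (computes_unpack x).seq ?_
    convert (computes_clear 1 (store [SearchProblems.car x, cdr x])).mono
      (n := x.length + 1) (by simpa [store] using length_cdr_le x) using 1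
    funext r; rcases r with _ | _ | r <;> simp [store]

theorem cdr (hf : PolyTime f) : PolyTime fun x => cdr (f x) := by
  refine comp (f := SearchProblems.cdr) (.intro (queryFree_seq queryFree_unpack <|
    queryFree_seq (queryFree_clear (a := 0)) queryFree_moveHome)
    (T := fun x => 9 * x.length + 6 + (x.length + 1 + (4 * x.length + 2))) ?_ fun x => ?_) hf
  · exact .add (.add (.mul (.const 9) .length) (.const 6)) <| .add (.add .length (.const 1)) <|
      .add (.mul (.const 4) .length) (.const 2)
  · have h1 := length_car_le x
    have h2 := length_cdr_le x
    exact ((computes_unpack x).seq <| (computes_clear_zero _ _).seq <|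
      computes_moveHome _).mono (by omega)

theorem branch (hh : PolyTime h) (hₑ : PolyTime fₑ) (h₀ : PolyTime f₀) (h₁ : PolyTime f₁) :
    PolyTime fun x => branch (h x) (fₑ x) (f₀ x) (f₁ x) := by
  have hl := hh.length
  have hlₑ := hₑ.length
  have hl₀ := h₀.length
  have hl₁ := h₁.length
  obtain ⟨A, hA, T, hT, hA'⟩ := exists_machine_two hh PolyTime.id
  obtain ⟨Aₑ, hAₑ, tₑ, hAₑ'⟩ := hₑ
  obtain ⟨A₀, hA₀, t₀, hA₀'⟩ := h₀
  obtain ⟨A₁, hA₁, t₁, hA₁'⟩ := h₁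
  let σ : ℕ → ℕ := fun r => 2 * r + 1
  refine .intro (queryFree_seq hA <| queryFree_seq (queryFree_popBranch (r := 0)
      (k₀ := false) (k₁ := false)
      (queryFree_seq (queryFree_clear (a := 0)) (queryFree_rename hA₀ σ))
      (queryFree_seq (queryFree_clear (a := 0)) (queryFree_rename hA₁ σ))
      (queryFree_rename hAₑ σ)) queryFree_moveHome)
    (T := fun x => T x + (((h x).length + 1 + tₑ.eval x.length + t₀.eval x.length +
      t₁.eval x.length + 1) + (4 * ((fₑ x).length + (f₀ x).length + (f₁ x).length) + 2)))
    ?_ fun x => (hA' x).seq ?_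
  · exact .add hT <| .add (.add (.add (.add (.add (.add hl (.const 1)) (.eval _ .length))
      (.eval _ .length)) (.eval _ .length)) (.const 1)) <|
      .add (.mul (.const 4) (.add (.add hlₑ hl₀) hl₁)) (.const 2)
  · have key : ∀ {B : Machine} {t : ℕ[X]} {k : Str → Str}, B.QueryFree →
        (∀ x, Computes B (store [x]) (t.eval x.length) (store [k x])) →
        Computes (Machine.rename σ B) (store [[], x]) (t.eval x.length) (store [[], k x]) := by
      intro B t k hB hB'
      rw [← interleave_store, ← interleave_store]
      exact (hB' x).odd hB _
    have hclear : ∀ (b : Bool) (w : Str), Computes (clear 0)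
        (Function.update (store [b :: w, x]) 0 w) (w.length + 1) (store [[], x]) := by
      intro b w
      convert computes_clear_zero w x using 1
      funext r; rcases r with _ | _ | r <;> simp [store]
    have main : Computes (popBranch 0 false false (seq (clear 0) (Machine.rename σ A₀))
        (seq (clear 0) (Machine.rename σ A₁)) (Machine.rename σ Aₑ)) (store [h x, x])
        ((h x).length + 1 + tₑ.eval x.length + t₀.eval x.length + t₁.eval x.length + 1)
        (store [[], SearchProblems.branch (h x) (fₑ x) (f₀ x) (f₁ x)]) := by
      intro O q
      rcases hx : h x with _ | ⟨_ | _, w⟩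
      · exact (Run.popBranch_nil rfl (key hAₑ hAₑ' O q)).mono (by simp; omega)
      · exact (Run.popBranch_exit (w := w) rfl rfl
          (((hclear false w).seq (key hA₀ hA₀')) O q)).mono (by simp; omega)
      · exact (Run.popBranch_exit (w := w) rfl rfl
          (((hclear true w).seq (key hA₁ hA₁')) O q)).mono (by simp; omega)
    refine (main.seq (computes_moveHome _)).mono (Nat.add_le_add_left ?_ _)
    rcases h x with _ | ⟨_ | _, w⟩ <;> simp [SearchProblems.branch] <;> omega

/-- Iteration: the function `f` may be applied `|n x|` times to `g x` if the intermediate results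
are bounded by a polynomial. -/
theorem iterate (hf : PolyTime f) (hn : PolyTime n) (hg : PolyTime g) {B : Str → ℕ}
    (hB : PolyBounded B) (h : ∀ x, ∀ i ≤ (n x).length, (f^[i] (g x)).length ≤ B x) :
    PolyTime fun x => f^[(n x).length] (g x) := by
  have hl := hn.length
  obtain ⟨A, hA, T, hT, hA'⟩ := exists_machine_two hn hg
  obtain ⟨F, hF, t, hF'⟩ := hf
  let σ : ℕ → ℕ := fun r => 2 * r + 1
  refine .intro (queryFree_seq hA <| queryFree_seq (queryFree_forEach (a := 0)
      (queryFree_rename hF σ) (queryFree_rename hF σ)) queryFree_moveHome)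
    (T := fun x => T x + (((t.eval (B x) + 1) * (n x).length + 1) + (4 * B x + 2)))
    ?_ fun x => (hA' x).seq ?_
  · exact .add hT <| .add (.add (.mul (.add (.eval t hB) (.const 1)) hl) (.const 1)) <|
      .add (.mul (.const 4) hB) (.const 2)
  · have main := computes_forEach (a := 0) (A₀ := Machine.rename σ F) (A₁ := Machine.rename σ F)
      (fun u w => store [w, f^[u.length] (g x)]) (t.eval (B x)) (n x) (fun _ _ => rfl)
      (fun u b v huv => by
        rw [Bool.cond_self]
        have e : Function.update (store [b :: v, f^[u.length] (g x)]) 0 v =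
            store [v, f^[u.length] (g x)] := by
          funext r; rcases r with _ | _ | r <;> simp [store]
        rw [e, List.length_cons, Function.iterate_succ_apply', ← interleave_store,
          ← interleave_store]
        exact ((hF' _).odd hF _).mono (eval_le_eval t (h x _ (by omega))))
    rw [List.length_reverse] at main
    exact (main.seq (computes_moveHome _)).mono (by have := h x _ le_rfl; omega)

end PolyTime

/-! ### Decidable relations and reductions in terms of polynomial-time functions -/

/-- A stack that is empty and never pushed to stays empty. -/
theorem stack_iterate_of_le {A : Machine} (hA : A.QueryFree) {K : ℕ}
    (hK : ∀ r b l, Instr.push r b l ∈ A → r < K) (O : Str → Str) {r : ℕ} (hr : K ≤ r) (n : ℕ)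
    (c : Config) (hc : c.stack r = []) : ((step A O)^[n] c).stack r = [] := by
  induction n generalizing c with
  | zero => exact hc
  | succ n ih =>
    refine ih _ ?_
    unfold step
    rcases h : A[c.state]? with _ | ⟨r', b, l⟩ | ⟨r', l₀, l₁, lₑ⟩ | ⟨l⟩
    · exact hc
    · have := hK r' b l (List.mem_of_getElem? h)
      simpa [show r ≠ r' by omega] using hc
    · rcases h' : c.stack r' with _ | ⟨b, w⟩
      · simpa [h'] using hc
      · have : r ≠ r' := by rintro rfl; simp [hc] at h'
        simpa [h', this] using hc
    · exact absurd (List.mem_of_getElem? h) (hA l)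

theorem exists_bound_push (A : Machine) : ∃ K, ∀ r b l, Instr.push r b l ∈ A → r < K := by
  induction A with
  | nil => exact ⟨0, by simp⟩
  | cons i A ih =>
    obtain ⟨K, hK⟩ := ih
    rcases i with ⟨r', b', l'⟩ | _ | _
    · refine ⟨max K (r' + 1), fun r b l h => ?_⟩
      rcases List.mem_cons.mp h with h | h
      · cases h; omega
      · have := hK r b l h; omega
    all_goals exact ⟨K, fun r b l h => hK r b l (by simpa using h)⟩

/-- Empty the stacks `1, …, K`. -/
def clearFrom : ℕ → Machine
  | 0 => []
  | K + 1 => seq (clearFrom K) (clear (K + 1))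

theorem queryFree_clearFrom (K : ℕ) : (clearFrom K).QueryFree := by
  induction K with
  | zero => exact queryFree_nil
  | succ K ih => exact queryFree_seq ih queryFree_clear

theorem computes_clearFrom (K : ℕ) (s : ℕ → Str) {m : ℕ} (hs : ∀ r, (s r).length ≤ m) :
    Computes (clearFrom K) s (K * (m + 1)) (fun r => if 1 ≤ r ∧ r ≤ K then [] else s r) := by
  induction K with
  | zero =>
    convert computes_nil s using 1
    · rfl
    · rw [Nat.zero_mul]
    · funext r; rw [if_neg (by omega)]
  | succ K ih =>
    have h := computes_clear (K + 1) (fun r => if 1 ≤ r ∧ r ≤ K then [] else s r)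
    rw [if_neg (by omega)] at h
    convert ih.seq (h.mono (n := m + 1) (by have := hs (K + 1); omega)) using 1
    · rfl
    · rw [Nat.succ_mul]
    · funext r
      by_cases hr : r = K + 1
      · simp [hr]
      · have : (1 ≤ r ∧ r ≤ K + 1) ↔ (1 ≤ r ∧ r ≤ K) := by omega
        simp [hr, this]

open Classical in
/-- The decision machine may leave garbage on the finitely many stacks it pushes to; it is made
clean by emptying these afterwards. -/
theorem PolyTimeDecidable.polyTime {R : Str → Str → Prop} (hR : PolyTimeDecidable R) :
    PolyTime fun w => if R (car w) (cdr w) then [true] else [false] := by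
  obtain ⟨M, t, hM, h⟩ := hR
  obtain ⟨K, hK⟩ := exists_bound_push M
  have ht : PolyBounded fun w => t.eval ((car w).length + (cdr w).length) :=
    (PolyBounded.length.eval t).mono fun w =>
      eval_le_eval t (by have := length_car_add_length_cdr w; omega)
  refine .intro (queryFree_seq queryFree_unpack (queryFree_seq hM (queryFree_clearFrom (K + 1))))
    (T := fun w => (9 * w.length + 6) + (t.eval ((car w).length + (cdr w).length) +
      (K + 1) * (w.length + t.eval ((car w).length + (cdr w).length) + 1))) ?_ fun w => ?_
  · exact .add (.add (.mul (.const 9) .length) (.const 6)) <| .add ht <|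
      .mul (.const _) (.add (.add .length ht) (.const 1))
  · refine (computes_unpack w).seq ?_
    obtain ⟨h1, h2⟩ := h (car w) (cdr w)
    set N := t.eval ((car w).length + (cdr w).length) with hN
    set c := run M (fun _ => []) [car w, cdr w] N with hc
    have hrun : Computes M (store [car w, cdr w]) N c.stack := by
      intro O q
      refine ⟨c.state, h1, ?_⟩
      have := iterate_step_queryFree hM O (fun _ => []) N (initial [car w, cdr w]) q
      exact this
    have hlen : ∀ r, (c.stack r).length ≤ w.length + N := by
      intro r
      refine (hrun.length_le hM r).trans (Nat.add_le_add_right ?_ _)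
      have := length_car_add_length_cdr w
      rcases r with _ | _ | r <;> simp [store] <;> omega
    have h3 := computes_clearFrom (K + 1) c.stack hlen
    convert hrun.seq h3 using 1
    funext r
    by_cases hr : 1 ≤ r ∧ r ≤ K + 1
    · rw [if_pos hr]
      obtain ⟨r, rfl⟩ := Nat.exists_eq_add_of_le' hr.1
      simp [store]
    · rw [if_neg hr]
      rcases r with _ | r
      · exact h2.symm
      · have hr' : K + 2 ≤ r + 1 := by omega
        rw [hc, run, stack_iterate_of_le hM hK _ (by omega) N _
          (by rcases r with _ | r
              · omega
              · simp [initial])]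
        simp [store]

open Classical in
theorem PolyTime.polyTimeDecidable {R : Str → Str → Prop} {f : Str → Str} (hf : PolyTime f)
    (h : ∀ x y, f (SearchProblems.pair x y) = if R x y then [true] else [false]) :
    PolyTimeDecidable R := by
  obtain ⟨A, hA, t, hA'⟩ := hf
  refine ⟨seq pack A, C 13 * X + 9 + t.comp (2 * X + 1), queryFree_seq queryFree_pack hA,
    fun x y => ?_⟩
  have h1 := ((computes_pack x y).seq (hA' _)).mono
    (n := (C 13 * X + 9 + t.comp (2 * X + 1)).eval (x.length + y.length)) (by
      have := eval_le_eval t (m := (SearchProblems.pair x y).length)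
        (n := 2 * (x.length + y.length) + 1) (by simp; omega)
      simp only [eval_add, eval_mul, eval_C, eval_X, eval_comp, eval_ofNat, eval_one]
      omega)
  obtain ⟨l, hl, h2⟩ := h1 (fun _ => []) 0
  have h3 : run (seq pack A) (fun _ => []) [x, y]
      ((C 13 * X + 9 + t.comp (2 * X + 1)).eval (x.length + y.length)) =
      ⟨l, store [f (SearchProblems.pair x y)], 0⟩ := h2
  rw [h3]
  exact ⟨hl, h x y⟩

/-- To reduce `Q` to `P` with one query, it suffices to give polynomial-time functions, the first
of which computes an instance of `P`, and the second one a solution of `Q` from this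
instance and any solution of it. -/
theorem TFNP.manyOneReducible_of_polyTime {Q P : TFNP} {f g : Str → Str} (hf : PolyTime f)
    (hg : PolyTime g)
    (h : ∀ x y, P.IsSolution (f x) y → Q.IsSolution x (g (SearchProblems.pair (f x) y))) :
    Q.ManyOneReducible P := by
  have hfl := hf.length
  obtain ⟨A, hA, T, hT, hA'⟩ := hf.exists_machine_two hf
  obtain ⟨B, hB, u, hB'⟩ := hg
  have hT' : PolyBounded fun x => T x + (1 + (4 * P.bound.eval (f x).length + 2 +
      (13 * (f x).length + 4 * P.bound.eval (f x).length + 9 +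
        u.eval (2 * (f x).length + 1 + P.bound.eval (f x).length)))) := by
    have hb := hfl.eval P.bound
    exact .add hT <| .add (.const 1) <| .add (.add (.mul (.const 4) hb) (.const 2)) <|
      .add (.add (.add (.mul (.const 13) hfl) (.mul (.const 4) hb)) (.const 9)) <|
      .eval u (.add (.add (.mul (.const 2) hfl) (.const 1)) hb)
  obtain ⟨t, ht⟩ := hT'
  refine ⟨seq A <| seq [Instr.query 1] <| seq (seq (move 2 3) (move 3 1)) <| seq pack B, t,
    fun O hO x => ?_⟩
  have hy := hO (f x)
  set y := O (f x) with hy_def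
  have h2 : Run O [Instr.query 1] (store [f x, f x]) 0 1 (store [f x, [], y]) 1 := by
    refine ⟨1, le_rfl, ?_⟩
    have e : Function.update (Function.update (store [f x, f x]) 1 []) 2
        (O (store [f x, f x] 1)) = store [f x, [], y] := by
      funext r; rcases r with _ | _ | _ | r <;> simp [store, hy_def]
    rw [← e]
    rfl
  have h3 := computes_move_store (a := 2) (b := 3) (by simp) (s := [f x, [], y])
    (s' := [f x, [], [], y.reverse])
    (by funext r; rcases r with _ | _ | _ | _ | r <;> simp [store])
  have h4 := computes_move_store (a := 3) (b := 1) (by simp) (s := [f x, [], [], y.reverse])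
    (s' := [f x, y])
    (by funext r; rcases r with _ | _ | _ | _ | r <;> simp [store])
  have h5 := ((hA' x) O 0).seq <| h2.seq <| ((h3.seq h4) O 1).seq <|
    ((computes_pack (f x) y).seq (hB' _)) O 1
  obtain ⟨l, hl, h6⟩ := h5.mono (n := t.eval x.length) (by
    refine le_trans ?_ (ht x)
    have := eval_le_eval u (m := 2 * (f x).length + 1 + y.length)
      (n := 2 * (f x).length + 1 + P.bound.eval (f x).length)
      (by have := hy.1; omega)
    have := hy.1
    simp [store] at this ⊢
    omega)
  have h7 : run (seq A <| seq [Instr.query 1] <| seq (seq (move 2 3) (move 3 1)) <| seq pack B) O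
      [x] (t.eval x.length) = ⟨l, store [g (SearchProblems.pair (f x) y)], 1⟩ := h6
  rw [h7]
  exact ⟨hl, h x y hy, rfl⟩

/-! ### Comparison of strings and association lists -/

theorem length_iterate_le {f : Str → Str} {k : ℕ} (hf : ∀ w, (f w).length ≤ w.length + k) (i : ℕ)
    (w : Str) : (f^[i] w).length ≤ w.length + i * k := by
  induction i with
  | zero => simp
  | succ i ih =>
    rw [Function.iterate_succ_apply', Nat.succ_mul]
    have := hf (f^[i] w)
    omega

/-- Remove the first bits of the components of a pair if they exist and agree. -/
def matchStep (w : Str) : Str :=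
  branch (car w) w (branch (cdr w) w (pair (car w).tail (cdr w).tail) w)
    (branch (cdr w) w w (pair (car w).tail (cdr w).tail))

theorem matchStep_cons (b : Bool) (u v : Str) :
    matchStep (pair (b :: u) (b :: v)) = pair u v := by
  cases b <;> simp [matchStep, branch]

theorem matchStep_of_ne {u v : Str} (h : ∀ b u' v', u = b :: u' → v ≠ b :: v') :
    matchStep (pair u v) = pair u v := by
  rcases u with _ | ⟨_ | _, u⟩ <;> rcases v with _ | ⟨_ | _, v⟩ <;> simp_all [matchStep, branch]

/-- Two strings are equal if and only if removing common first bits leaves nothing of either. -/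
theorem iterate_matchStep (u v : Str) :
    (car (matchStep^[u.length] (pair u v)) = [] ∧ cdr (matchStep^[u.length] (pair u v)) = []) ↔
      u = v := by
  induction u generalizing v with
  | nil => simp [eq_comm]
  | cons b u ih =>
    by_cases h : ∃ v', v = b :: v'
    · obtain ⟨v', rfl⟩ := h
      rw [List.length_cons, Function.iterate_succ_apply, matchStep_cons, ih]
      simp
    · rw [Function.iterate_fixed (matchStep_of_ne
        (by rintro b' u' v' h' rfl; cases h'; exact h ⟨_, rfl⟩))]
      simp only [car_pair, cdr_pair, reduceCtorEq, false_and, false_iff]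
      exact fun h' => h ⟨u, h'.symm⟩

theorem length_matchStep_le (w : Str) : (matchStep w).length ≤ w.length := by
  have := length_car_add_length_cdr w
  unfold matchStep
  rcases hu : car w with _ | ⟨_ | _, u⟩ <;> rcases hv : cdr w with _ | ⟨_ | _, v⟩ <;>
    simp_all [branch] <;> omega

namespace PolyTime

variable {f g : Str → Str}

theorem eq (hf : PolyTime f) (hg : PolyTime g) :
    PolyTime fun x => if f x = g x then [true] else [] := by
  have hfg := hf.pair hg
  have hs : PolyTime matchStep :=
    .branch (.car .id) .id
      (.branch (.cdr .id) .id (.pair (.tail (.car .id)) (.tail (.cdr .id))) .id)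
      (.branch (.cdr .id) .id .id (.pair (.tail (.car .id)) (.tail (.cdr .id))))
  have hi := iterate hs hf hfg hfg.length (fun x i _ => by
    simpa using length_iterate_le (k := 0) length_matchStep_le i
      (SearchProblems.pair (f x) (g x)))
  have := hi.car.branch (hi.cdr.branch (.const [true]) (.const []) (.const [])) (.const [])
    (.const [])
  convert this using 2 with x
  have h := iterate_matchStep (f x) (g x)
  generalize matchStep^[(f x).length] (SearchProblems.pair (f x) (g x)) = w at h ⊢
  simp only [← h]
  rcases SearchProblems.car w with _ | ⟨_ | _, u⟩ <;>
    rcases SearchProblems.cdr w with _ | ⟨_ | _, v⟩ <;> simp [SearchProblems.branch]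

/-- Selection by equality of strings. -/
theorem ite_eq {h k : Str → Str} (hf : PolyTime f) (hg : PolyTime g) (hh : PolyTime h)
    (hk : PolyTime k) : PolyTime fun x => if f x = g x then h x else k x := by
  convert (hf.eq hg).branch hk hk hh using 2 with x
  split_ifs <;> rfl

end PolyTime

/-- One step of the search for the key `q` in the association list `t`, where `w = pair q t`: an
association list is a nested pair `pair (pair r₁ v₁) (pair (pair r₂ v₂) …)`. -/
def scanStep (w : Str) : Str :=
  if car (car (cdr w)) = car w then w else pair (car w) (cdr (cdr w))

/-- The value of the key `q` in the association list `t`; `[]` if there is none. -/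
def lookup (q t : Str) : Str := cdr (car (cdr (scanStep^[t.length] (pair q t))))

/-- The association list `t` with the value of the key `r` changed to `v`. -/
def write (r v t : Str) : Str := pair (pair r v) t

theorem length_scanStep_le (w : Str) : (scanStep w).length ≤ w.length + 1 := by
  have := length_car_add_length_cdr w
  have := length_cdr_le (cdr w)
  unfold scanStep
  split_ifs
  · omega
  · rw [length_pair]; omega

theorem PolyTime.lookup {f g : Str → Str} (hf : PolyTime f) (hg : PolyTime g) :
    PolyTime fun x => lookup (f x) (g x) := by
  have hs : PolyTime scanStep :=
    .ite_eq (.car (.car (.cdr .id))) (.car .id) .id (.pair (.car .id) (.cdr (.cdr .id)))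
  refine .cdr <| .car <| .cdr <| iterate hs hg (hf.pair hg)
    ((hf.pair hg).length.add hg.length) fun x i hi => ?_
  have := length_iterate_le (k := 1) length_scanStep_le i (SearchProblems.pair (f x) (g x))
  omega

theorem PolyTime.write {f g h : Str → Str} (hf : PolyTime f) (hg : PolyTime g)
    (hh : PolyTime h) : PolyTime fun x => write (f x) (g x) (h x) := (hf.pair hg).pair hh

theorem cdr_iterate_scanStep (q t : Str) (n : ℕ) :
    scanStep^[n] (pair q t) = pair q (cdr (scanStep^[n] (pair q t))) := by
  induction n with
  | zero => simp
  | succ n ih =>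
    rw [Function.iterate_succ_apply', ih]
    unfold scanStep
    split_ifs <;> simp

theorem scanStep_pair (q t : Str) :
    scanStep (pair q t) = if car (car t) = q then pair q t else pair q (cdr t) := by
  simp [scanStep]

theorem length_cdr_lt {w : Str} (h : w ≠ []) : (cdr w).length < w.length := by
  fun_induction cdr w with
  | case1 _ w ih =>
    have := length_cdr_le w
    simp; omega
  | case2 w => simp
  | case3 w _ _ => simpa [List.length_pos_iff] using h

/-- Once the search has run for `|t|` steps, further steps have no effect. -/
theorem iterate_scanStep_of_le (q : Str) {n : ℕ} {t : Str} (h : t.length ≤ n) :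
    scanStep^[n] (pair q t) = scanStep^[t.length] (pair q t) := by
  have key : ∀ (n : ℕ) (t : Str), t.length ≤ n →
      scanStep (scanStep^[n] (pair q t)) = scanStep^[n] (pair q t) := by
    intro n
    induction n with
    | zero =>
      intro t ht
      rw [List.length_eq_zero_iff.mp (Nat.le_zero.mp ht)]
      simp [scanStep_pair]
    | succ n ih =>
      intro t ht
      by_cases h : car (car t) = q
      · have hfix : scanStep (pair q t) = pair q t := by rw [scanStep_pair, if_pos h]
        rw [Function.iterate_fixed hfix, hfix]
      · rw [Function.iterate_succ_apply, scanStep_pair, if_neg h]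
        refine ih _ ?_
        rcases eq_or_ne t [] with rfl | hne
        · simp
        · have := length_cdr_lt hne
          omega
  obtain ⟨k, rfl⟩ := Nat.exists_eq_add_of_le' h
  rw [Function.iterate_add_apply, Function.iterate_fixed (key _ _ le_rfl)]

@[simp] theorem lookup_nil (q : Str) : lookup q [] = [] := by simp [lookup]

theorem lookup_write (q r v t : Str) :
    lookup q (write r v t) = if r = q then v else lookup q t := by
  have h1 : scanStep (pair q (write r v t)) =
      if r = q then pair q (write r v t) else pair q t := by simp [scanStep_pair, write]
  split_ifs at h1 ⊢ with h
  · rw [lookup, Function.iterate_fixed h1]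
    simp [write]
  · have h2 : (write r v t).length = (2 * (pair r v).length + t.length) + 1 := by
      simp only [write, length_pair]; omega
    rw [lookup, h2, Function.iterate_succ_apply, h1, iterate_scanStep_of_le q (by omega), lookup]

theorem length_lookup_le (q t : Str) : (lookup q t).length ≤ t.length := by
  have key : ∀ n, (cdr (scanStep^[n] (pair q t))).length ≤ t.length := by
    intro n
    induction n with
    | zero => simp
    | succ n ih =>
      rw [Function.iterate_succ_apply', cdr_iterate_scanStep, scanStep_pair]
      have := length_cdr_le (cdr (scanStep^[n] (pair q t)))
      split_ifs <;> simp <;> omega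
  have h1 := key t.length
  have h2 := length_car_le (cdr (scanStep^[t.length] (pair q t)))
  have h3 := length_cdr_le (car (cdr (scanStep^[t.length] (pair q t))))
  unfold lookup
  omega

/-- The association list with the keys in `l`, in which `O` gives the values. -/
def table (O : Str → Str) : List Str → Str
  | [] => []
  | q :: l => write q (O q) (table O l)

theorem lookup_table (O : Str → Str) {l : List Str} {q : Str} (h : q ∈ l) :
    lookup q (table O l) = O q := by
  induction l with
  | nil => simp at h
  | cons r l ih =>
    rw [table, lookup_write]
    split_ifs with hr
    · rw [hr]
    · exact ih ((List.mem_cons.mp h).resolve_left (Ne.symm hr))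

theorem length_table_le {O : Str → Str} {l : List Str} {k m : ℕ}
    (h : ∀ q ∈ l, q.length ≤ k ∧ (O q).length ≤ m) :
    (table O l).length ≤ l.length * (4 * k + 2 * m + 3) := by
  induction l with
  | nil => simp [table]
  | cons q l ih =>
    have h1 := ih fun r hr => h r (List.mem_cons_of_mem _ hr)
    have h2 := h q List.mem_cons_self
    rw [table, write, length_pair, length_pair, List.length_cons, Nat.succ_mul l.length]
    omega

/-! ### Unary arithmetic -/

/-- The unary notation of a number. -/
def unary (n : ℕ) : Str := List.replicate n true

theorem unary_injective : Function.Injective unary := List.replicate_left_injective true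

@[simp] theorem length_unary (n : ℕ) : (unary n).length = n := List.length_replicate

namespace PolyTime

variable {f g : Str → Str}

theorem unary_length (hf : PolyTime f) : PolyTime fun x => unary (f x).length := by
  have hs : PolyTime fun w => true :: w := .cons true .id
  have hk : ∀ i : ℕ, (fun w => true :: w)^[i] [] = unary i := by
    intro i
    induction i with
    | zero => rfl
    | succ i ih => rw [Function.iterate_succ_apply', ih]; rfl
  have := iterate hs hf (.const []) hf.length fun x i hi => by rwa [hk, length_unary]
  simpa only [hk] using this

theorem unary_add (hf : PolyTime f) (hg : PolyTime g) :
    PolyTime fun x => unary ((f x).length + (g x).length) := by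
  have hs : PolyTime fun w => true :: w := .cons true .id
  have hk : ∀ i j : ℕ, (fun w => true :: w)^[i] (unary j) = unary (i + j) := by
    intro i j
    induction i with
    | zero => rw [Nat.zero_add]; rfl
    | succ i ih => rw [Function.iterate_succ_apply', ih, Nat.add_right_comm]; rfl
  have := iterate hs hf hg.unary_length (hf.length.add hg.length) fun x i hi => by
    rw [hk, length_unary]; omega
  simpa only [hk] using this

theorem unary_mul (hf : PolyTime f) (hg : PolyTime g) :
    PolyTime fun x => unary ((f x).length * (g x).length) := by
  have hs : PolyTime fun w => SearchProblems.pair (SearchProblems.car w)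
      (unary ((SearchProblems.car w).length + (SearchProblems.cdr w).length)) :=
    .pair (.car .id) (.unary_add (.car .id) (.cdr .id))
  have hk : ∀ (u : Str) (i : ℕ), (fun w => SearchProblems.pair (SearchProblems.car w)
      (unary ((SearchProblems.car w).length + (SearchProblems.cdr w).length)))^[i]
        (SearchProblems.pair u []) = SearchProblems.pair u (unary (i * u.length)) := by
    intro u i
    induction i with
    | zero => rw [Nat.zero_mul]; rfl
    | succ i ih =>
      rw [Function.iterate_succ_apply', ih, Nat.succ_mul, Nat.add_comm]
      simp
  have := iterate hs hf (hg.pair (.const [])) (B := fun x => 2 * (g x).length + 1 +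
      (f x).length * (g x).length) (.add (.add (.mul (.const 2) hg.length) (.const 1))
      (hf.length.mul hg.length)) fun x i hi => by
    rw [hk, length_pair, length_unary]
    exact Nat.add_le_add_left (Nat.mul_le_mul_right _ hi) _
  simpa only [hk, cdr_pair] using this.cdr

theorem unary_eval (p : ℕ[X]) : PolyTime fun x => unary (p.eval x.length) := by
  induction p using Polynomial.induction_on with
  | C a => simpa using const (unary a)
  | add p q hp hq => simpa using hp.unary_add hq
  | monomial n a h => simpa [pow_succ, mul_assoc] using h.unary_mul id

end PolyTime

open Classical in
/-- Checking solutions is a polynomial-time task, including the bound on the length. -/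
theorem TFNP.polyTime_isSolution (P : TFNP) :
    PolyTime fun w => if P.IsSolution (car w) (cdr w) then [true] else [] := by
  have hdrop : PolyTime fun w => List.tail^[(unary (P.bound.eval (car w).length)).length] (cdr w) :=
    PolyTime.iterate (.tail .id) ((PolyTime.unary_eval P.bound).comp (.car .id)) (.cdr .id)
      PolyBounded.length fun w i _ => by
        refine (length_iterate_le (k := 0) (fun w => by simp) i (cdr w)).trans ?_
        simpa using length_cdr_le w
  convert P.polyTime.polyTime.branch (.const []) (.const [])
    (hdrop.branch (.const [true]) (.const []) (.const [])) using 2 with w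
  have htail : ∀ (n : ℕ) (v : Str), List.tail^[n] v = v.drop n := by
    intro n v
    induction n with
    | zero => simp
    | succ n ih => rw [Function.iterate_succ_apply', ih, List.tail_drop]
  rw [htail, length_unary]
  by_cases h1 : P.rel (car w) (cdr w)
  · by_cases h2 : (cdr w).length ≤ P.bound.eval (car w).length
    · simp [TFNP.IsSolution, h1, h2, branch, List.drop_eq_nil_of_le h2]
    · have h3 : (cdr w).drop (P.bound.eval (car w).length) ≠ [] := by
        rwa [Ne, List.drop_eq_nil_iff]
      obtain ⟨b, u, h3⟩ := List.exists_cons_of_ne_nil h3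
      rw [h3]
      cases b <;> simp [TFNP.IsSolution, h1, h2, branch]
  · simp [TFNP.IsSolution, h1, branch]

/-! ### The universal oracle machine -/

/-- A configuration of the universal machine: the current state of the simulated machine, its
stacks (an association list), and a flag, which is `[]` as soon as some query has been
answered incorrectly. -/
structure UConfig : Type where
  state : Str
  mem : Str
  ok : Str

/-- The `k`-th entry of a list coded as a nested pair. -/
def entry (k : ℕ) (i : Str) : Str := car (cdr^[k] i)

/-- One step of the universal machine.  The program `code` is an association list, with states as
keys; the instruction `pair tag (pair op (pair r (pair l₀ (pair l₁ (pair lₑ []))))` is no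
instruction at all if `tag` is empty, and a query if `tag` starts with `false`; otherwise it
is a pop if `op` is empty, and pushes the first bit of `op` if not.  The function `ans` gives the
answers to queries, and `chk` tests them. -/
def ustep (chk ans : Str → Str) (code : Str) (c : UConfig) : UConfig :=
  let i := lookup c.state code
  let r := entry 2 i
  let l₀ := entry 3 i
  let v := lookup r c.mem
  let q := lookup (unary 1) c.mem
  match entry 0 i with
  | [] => c
  | false :: _ =>
    ⟨l₀, write (unary 2) (ans q) (write (unary 1) [] c.mem),
      branch (chk (pair q (ans q))) [] [] c.ok⟩
  | true :: _ =>
    match entry 1 i with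
    | b :: _ => ⟨l₀, write r (b :: v) c.mem, c.ok⟩
    | [] =>
      match v with
      | [] => ⟨entry 5 i, c.mem, c.ok⟩
      | b :: w => ⟨if b then entry 4 i else l₀, write r w c.mem, c.ok⟩

/-- The initial configuration of the universal machine for the input `z`. -/
def uinit (z : Str) : UConfig := ⟨unary 0, write (unary 0) z [], [true]⟩

theorem length_entry_le (k : ℕ) (i : Str) : (entry k i).length ≤ i.length := by
  refine (length_car_le _).trans ?_
  simpa using length_iterate_le (k := 0) length_cdr_le k i

theorem PolyTime.entry {f : Str → Str} (k : ℕ) (hf : PolyTime f) :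
    PolyTime fun x => entry k (f x) := by
  refine .car ?_
  induction k with
  | zero => exact hf
  | succ k ih => simpa only [Function.iterate_succ_apply'] using ih.cdr

/-- A configuration of the universal machine together with the program and a table of
answers, as a string. -/
def encode (code y : Str) (c : UConfig) : Str :=
  pair code (pair y (pair c.state (pair c.mem c.ok)))

/-- On codes of configurations, a step of the universal machine is a polynomial-time function. -/
theorem exists_polyTime_ustep {chk : Str → Str} (hchk : PolyTime chk) :
    ∃ f, PolyTime f ∧ ∀ code y c,
      f (encode code y c) = encode code y (ustep chk (fun q => lookup q y) code c) := by
  have hcode : PolyTime fun w => car w := .car .id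
  have hy : PolyTime fun w => car (cdr w) := .car (.cdr .id)
  have hstate : PolyTime fun w => car (cdr (cdr w)) := .car (.cdr (.cdr .id))
  have hmem : PolyTime fun w => car (cdr (cdr (cdr w))) := .car (.cdr (.cdr (.cdr .id)))
  have hok : PolyTime fun w => cdr (cdr (cdr (cdr w))) := .cdr (.cdr (.cdr (.cdr .id)))
  have henc : ∀ {f g h : Str → Str}, PolyTime f → PolyTime g → PolyTime h →
      PolyTime fun w => encode (car w) (car (cdr w)) ⟨f w, g w, h w⟩ :=
    fun hf hg hh => hcode.pair (hy.pair (hf.pair (hg.pair hh)))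
  have hi := hstate.lookup hcode
  have hv := (hi.entry 2).lookup hmem
  have hq := (PolyTime.const (unary 1)).lookup hmem
  have ha := hq.lookup hy
  refine ⟨_, (hi.entry 0).branch .id
    (henc (hi.entry 3) ((PolyTime.const (unary 2)).write ha
      ((PolyTime.const (unary 1)).write (.const []) hmem))
      ((hchk.comp (hq.pair ha)).branch (.const []) (.const []) hok))
    ((hi.entry 1).branch
      (hv.branch (henc (hi.entry 5) hmem hok)
        (henc (hi.entry 3) ((hi.entry 2).write hv.tail hmem) hok)
        (henc (hi.entry 4) ((hi.entry 2).write hv.tail hmem) hok))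
      (henc (hi.entry 3) ((hi.entry 2).write (hv.cons false) hmem) hok)
      (henc (hi.entry 3) ((hi.entry 2).write (hv.cons true) hmem) hok)), fun code y c => ?_⟩
  simp only [encode, ustep, car_pair, cdr_pair]
  rcases entry 0 (lookup c.state code) with _ | ⟨_ | _, _⟩
  · rfl
  · rfl
  · rcases entry 1 (lookup c.state code) with _ | ⟨_ | _, _⟩
    · rcases lookup (entry 2 (lookup c.state code)) c.mem with _ | ⟨_ | _, _⟩ <;> rfl
    · rfl
    · rfl

section bounds

variable {chk ans : Str → Str} {code : Str} {c : UConfig}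

/-- The simulated stacks grow by at most one bit in each step, up to the length of the answers. -/
theorem length_lookup_ustep_le {m : ℕ} (hans : ∀ q, (ans q).length ≤ m)
    (hm : ∀ r, (lookup r c.mem).length ≤ m) (r : Str) :
    (lookup r (ustep chk ans code c).mem).length ≤ m + 1 := by
  have h0 := hm r
  unfold ustep
  dsimp only
  split
  · omega
  · simp only [lookup_write]
    have := hans (lookup (unary 1) c.mem)
    split_ifs <;> simp <;> omega
  · split
    · simp only [lookup_write]
      have := hm (entry 2 (lookup c.state code))
      split_ifs <;> simp <;> omega
    · split
      · dsimp only; omega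
      · rename_i b w hw
        simp only [lookup_write]
        have := hm (entry 2 (lookup c.state code))
        rw [hw, List.length_cons] at this
        split_ifs <;> omega

theorem length_mem_ustep_le {m : ℕ} (hans : ∀ q, (ans q).length ≤ m)
    (hm : ∀ r, (lookup r c.mem).length ≤ m) :
    (ustep chk ans code c).mem.length ≤ c.mem.length + (4 * code.length + 2 * m + 20) := by
  have hr : (entry 2 (lookup c.state code)).length ≤ code.length :=
    (length_entry_le _ _).trans (length_lookup_le _ _)
  have hv := hm (entry 2 (lookup c.state code))
  unfold ustep
  dsimp only
  split
  · omega
  · have := hans (lookup (unary 1) c.mem)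
    simp only [write, length_pair, length_unary, List.length_nil]
    omega
  · split
    · simp only [write, length_pair, List.length_cons]
      omega
    · split
      · dsimp only; omega
      · rename_i b w hw
        rw [hw, List.length_cons] at hv
        simp only [write, length_pair]
        omega

theorem length_state_ustep_le (hc : c.state.length ≤ code.length) :
    (ustep chk ans code c).state.length ≤ code.length := by
  have he : ∀ k, (entry k (lookup c.state code)).length ≤ code.length := fun k =>
    (length_entry_le _ _).trans (length_lookup_le _ _)
  unfold ustep
  dsimp only
  split
  · exact hc
  · exact he 3
  · split
    · exact he 3
    · split
      · exact he 5
      · dsimp only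
        split
        exacts [he 4, he 3]

theorem length_ok_ustep_le : (ustep chk ans code c).ok.length ≤ c.ok.length := by
  unfold ustep
  dsimp only
  split
  · rfl
  · generalize chk (pair (lookup (unary 1) c.mem) (ans (lookup (unary 1) c.mem))) = w
    rcases w with _ | ⟨_ | _, _⟩ <;> simp [branch]
  · split
    · rfl
    · split <;> rfl

theorem length_iterate_ustep_le {m : ℕ} (hans : ∀ q, (ans q).length ≤ m) (z : Str) (i : ℕ) :
    ((ustep chk ans code)^[i] (uinit z)).state.length ≤ code.length ∧
    ((ustep chk ans code)^[i] (uinit z)).ok.length ≤ 1 ∧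
    (∀ r, (lookup r ((ustep chk ans code)^[i] (uinit z)).mem).length ≤ m + z.length + i) ∧
    ((ustep chk ans code)^[i] (uinit z)).mem.length ≤
      3 + 2 * z.length + i * (4 * code.length + 2 * (m + z.length + i) + 20) := by
  induction i with
  | zero =>
    refine ⟨by simp [uinit, unary], by simp [uinit], fun r => ?_, ?_⟩
    · simp only [uinit, Function.iterate_zero_apply, lookup_write]
      split_ifs <;> simp
    · simp only [uinit, Function.iterate_zero_apply, write, length_pair, length_unary,
        List.length_nil]
      omega
  | succ i ih =>
    obtain ⟨h1, h2, h3, h4⟩ := ih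
    rw [Function.iterate_succ_apply']
    refine ⟨length_state_ustep_le h1, length_ok_ustep_le.trans h2,
      length_lookup_ustep_le (fun q => (hans q).trans (by omega : m ≤ m + z.length + i)) h3, ?_⟩
    have h5 := length_mem_ustep_le (chk := chk) (code := code)
      (fun q => (hans q).trans (by omega : m ≤ m + z.length + i)) h3
    have h6 : i * (4 * code.length + 2 * (m + z.length + i) + 20) ≤
        i * (4 * code.length + 2 * (m + z.length + (i + 1)) + 20) :=
      Nat.mul_le_mul_left _ (by omega)
    rw [Nat.succ_mul i]
    omega

end bounds

/-- The universal machine runs in polynomial time, its input `pair X y` consisting of an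
instance `X = pair code (pair z T)` and a table `y` of answers; it simulates `|T|` steps of
the program `code` on the input `z`. -/
theorem polyTime_universal {chk : Str → Str} (hchk : PolyTime chk) :
    PolyTime fun w => encode (car (car w)) (cdr w)
      ((ustep chk (fun q => lookup q (cdr w)) (car (car w)))^[(cdr (cdr (car w))).length]
        (uinit (car (cdr (car w))))) := by
  obtain ⟨f, hf, hfs⟩ := exists_polyTime_ustep hchk
  have hk : ∀ (code y : Str) (c : UConfig) (i : ℕ), f^[i] (encode code y c) =
      encode code y ((ustep chk (fun q => lookup q y) code)^[i] c) := by
    intro code y c i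
    induction i with
    | zero => rfl
    | succ i ih => rw [Function.iterate_succ_apply', Function.iterate_succ_apply', ih, hfs]
  have hg : PolyTime fun w => encode (car (car w)) (cdr w) (uinit (car (cdr (car w)))) :=
    .pair (.car (.car .id)) (.pair (.cdr .id) (.pair (.const _) (.pair
      (.write (.const _) (.car (.cdr (.car .id))) (.const _)) (.const _))))
  have := PolyTime.iterate hf (.cdr (.cdr (.car .id))) hg
    (B := fun w => 20 * w.length + 20 + 2 * (w.length * (10 * w.length + 20))) ?_ ?_
  · simpa only [hk] using this
  · exact .add (.add (.mul (.const 20) .length) (.const 20)) (.mul (.const 2) (.mul .length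
      (.add (.mul (.const 10) .length) (.const 20))))
  · intro w i hi
    have e1 := length_car_le w
    have e2 := length_cdr_le w
    have e3 := length_car_le (car w)
    have e4 := length_cdr_le (car w)
    have e5 := length_car_le (cdr (car w))
    have e6 := length_cdr_le (cdr (car w))
    obtain ⟨h1, h2, -, h4⟩ := length_iterate_ustep_le (chk := chk) (code := car (car w))
      (fun q => length_lookup_le q (cdr w)) (car (cdr (car w))) i
    have h5 : i * (4 * (car (car w)).length +
        2 * ((cdr w).length + (car (cdr (car w))).length + i) + 20) ≤
        w.length * (10 * w.length + 20) := Nat.mul_le_mul (by omega) (by omega)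
    rw [hk]
    simp only [encode, length_pair]
    omega

/-! ### Simulation of machines -/

/-- The code of an instruction, as expected by `ustep`; missing entries are empty. -/
def Instr.code : Instr → Str
  | push r b l => pair [true] (pair [b] (pair (unary r) (pair (unary l) [])))
  | pop r l₀ l₁ lₑ =>
    pair [true] (pair [] (pair (unary r) (pair (unary l₀) (pair (unary l₁) (pair (unary lₑ) [])))))
  | query l => pair [false] (pair [] (pair [] (pair (unary l) [])))

/-- The code of the instructions of a machine from state `k` on. -/
def codeFrom (k : ℕ) : Machine → Str
  | [] => []
  | i :: M => write (unary k) i.code (codeFrom (k + 1) M)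

theorem lookup_codeFrom (M : Machine) (k l : ℕ) :
    lookup (unary (k + l)) (codeFrom k M) = (M[l]?).elim [] Instr.code := by
  induction M generalizing k l with
  | nil => simp [codeFrom]
  | cons i M ih =>
    simp only [codeFrom, lookup_write, unary_injective.eq_iff]
    rcases l with _ | l
    · simp
    · rw [if_neg (by omega), List.getElem?_cons_succ, ← ih (k + 1) l]
      congr 2
      omega

theorem lookup_codeFrom_zero (M : Machine) (l : ℕ) :
    lookup (unary l) (codeFrom 0 M) = (M[l]?).elim [] Instr.code := by
  simpa using lookup_codeFrom M 0 l

/-- The universal machine's configuration `u` represents the configuration `c`. -/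
def Represents (u : UConfig) (c : Config) : Prop :=
  u.state = unary c.state ∧ ∀ r, lookup (unary r) u.mem = c.stack r

theorem represents_uinit (x : Str) : Represents (uinit x) (initial [x]) := by
  refine ⟨rfl, fun r => ?_⟩
  simp only [uinit, lookup_write, unary_injective.eq_iff, initial]
  rcases r with _ | r <;> simp

theorem Represents.step {u : UConfig} {c : Config} (h : Represents u c) (chk : Str → Str)
    (M : Machine) (O : Str → Str) :
    Represents (ustep chk O (codeFrom 0 M) u) (step M O c) := by
  obtain ⟨h1, h2⟩ := h
  unfold ustep SearchProblems.step
  rw [h1, lookup_codeFrom_zero]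
  rcases M[c.state]? with _ | ⟨r, b, l⟩ | ⟨r, l₀, l₁, lₑ⟩ | ⟨l⟩
  · exact ⟨h1, h2⟩
  · refine ⟨by simp [entry, Instr.code], fun r' => ?_⟩
    simp [entry, Instr.code, lookup_write, unary_injective.eq_iff, h2, Function.update_apply,
      eq_comm]
  · simp only [entry, Instr.code, Option.elim, Function.iterate_zero_apply,
      Function.iterate_succ_apply, car_pair, cdr_pair, h2]
    rcases hc : c.stack r with _ | ⟨b, w⟩
    · exact ⟨rfl, h2⟩
    · refine ⟨by cases b <;> rfl, fun r' => ?_⟩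
      simp [lookup_write, unary_injective.eq_iff, h2, Function.update_apply, eq_comm]
  · refine ⟨by simp [entry, Instr.code], fun r' => ?_⟩
    simp only [entry, Instr.code, Option.elim, Function.iterate_zero_apply, car_pair,
      lookup_write, unary_injective.eq_iff, h2, Function.update_apply]
    rcases eq_or_ne r' 2 with rfl | hr
    · simp
    · rcases eq_or_ne r' 1 with rfl | hr'
      · simp
      · simp [hr, hr', hr.symm, hr'.symm]

theorem represents_run (chk : Str → Str) (M : Machine) (O : Str → Str) (x : Str) (n : ℕ) :
    Represents ((ustep chk O (codeFrom 0 M))^[n] (uinit x)) (run M O [x] n) := by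
  induction n with
  | zero => exact represents_uinit x
  | succ n ih =>
    rw [run, Function.iterate_succ_apply', Function.iterate_succ_apply']
    exact ih.step chk M O

/-! ### Answers to the queries of the universal machine -/

section answers

variable {chk ans : Str → Str} {code : Str} {c : UConfig}

theorem ustep_congr {ans' : Str → Str}
    (h : ans' (lookup (unary 1) c.mem) = ans (lookup (unary 1) c.mem)) :
    ustep chk ans' code c = ustep chk ans code c := by
  simp only [ustep, h]

theorem ok_of_ok_ustep (h : (ustep chk ans code c).ok ≠ []) : c.ok ≠ [] := by
  rw [← List.length_pos_iff] at h ⊢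
  exact h.trans_le length_ok_ustep_le

/-- If no wrong answer has been detected, then an oracle whose answers agree with those of `ans`
that pass the test makes no difference. -/
theorem ustep_eq_of_ok {O : Str → Str} (hO : ∀ q, chk (pair q (ans q)) = [true] → O q = ans q)
    (hchk : ∀ w, chk w = [true] ∨ chk w = []) (h : (ustep chk ans code c).ok ≠ []) :
    ustep chk ans code c = ustep chk O code c := by
  rcases hchk (pair (lookup (unary 1) c.mem) (ans (lookup (unary 1) c.mem))) with h1 | h1
  · exact (ustep_congr (hO _ h1)).symm
  · unfold ustep at h ⊢
    dsimp only at h ⊢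
    split at h
    · rfl
    · simp [h1, branch] at h
    · rfl

theorem iterate_ustep_eq_of_ok {O : Str → Str}
    (hO : ∀ q, chk (pair q (ans q)) = [true] → O q = ans q)
    (hchk : ∀ w, chk w = [true] ∨ chk w = []) (n : ℕ)
    (h : ((ustep chk ans code)^[n] c).ok ≠ []) :
    (ustep chk ans code)^[n] c = (ustep chk O code)^[n] c := by
  induction n with
  | zero => rfl
  | succ n ih =>
    rw [Function.iterate_succ_apply'] at h ⊢
    rw [ustep_eq_of_ok hO hchk h, ih (ok_of_ok_ustep h), Function.iterate_succ_apply']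

theorem ok_ustep (h : ∀ q, chk (pair q (ans q)) = [true]) : (ustep chk ans code c).ok = c.ok := by
  unfold ustep
  dsimp only
  split
  · rfl
  · simp [h, branch]
  · split
    · rfl
    · split <;> rfl

theorem ok_iterate_ustep (h : ∀ q, chk (pair q (ans q)) = [true]) (n : ℕ) :
    ((ustep chk ans code)^[n] c).ok = c.ok := by
  induction n with
  | zero => rfl
  | succ n ih => rw [Function.iterate_succ_apply', ok_ustep h, ih]

theorem length_query_ustep_le :
    (lookup (unary 1) (ustep chk ans code c).mem).length ≤ (lookup (unary 1) c.mem).length + 1 := by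
  unfold ustep
  dsimp only
  split
  · omega
  · simp [lookup_write, unary_injective.eq_iff]
  · split
    · rw [lookup_write]
      split_ifs with h <;> simp [h]
    · split
      · dsimp only; omega
      · rename_i b w hw
        rw [lookup_write]
        split_ifs with h
        · rw [← h, hw]; simp; omega
        · omega

/-- The `i`-th query has length at most `i`, whatever the answers are: the query stack starts
empty, is erased by each query, and grows by at most one bit in each step. -/
theorem length_query_le (z : Str) (i : ℕ) :
    (lookup (unary 1) ((ustep chk ans code)^[i] (uinit z)).mem).length ≤ i := by
  induction i with
  | zero => simp [uinit, lookup_write, unary_injective.eq_iff]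
  | succ i ih =>
    rw [Function.iterate_succ_apply']
    exact length_query_ustep_le.trans (by omega)

/-- A run with oracle `O` is reproduced by a table of the answers given in it. -/
theorem iterate_ustep_table (O : Str → Str) (n : ℕ) :
    (ustep chk (fun q => lookup q (table O ((List.range n).map fun i =>
      lookup (unary 1) ((ustep chk O code)^[i] c).mem))) code)^[n] c =
    (ustep chk O code)^[n] c := by
  have key : ∀ m ≤ n, (ustep chk (fun q => lookup q (table O ((List.range n).map fun i =>
      lookup (unary 1) ((ustep chk O code)^[i] c).mem))) code)^[m] c =
      (ustep chk O code)^[m] c := by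
    intro m
    induction m with
    | zero => intro _; rfl
    | succ m ih =>
      intro hm
      rw [Function.iterate_succ_apply', Function.iterate_succ_apply', ih (by omega)]
      exact ustep_congr (lookup_table O (List.mem_map.mpr ⟨m, by simpa using hm, rfl⟩))
  exact key n le_rfl

end answers

/-! ### The complete problem for reductions to `P` -/

namespace TFNP

variable (P : TFNP)

open Classical in
/-- The test whether `w` is a pair of an instance of `P` and a solution of it. -/
noncomputable def test (w : Str) : Str := if P.IsSolution (car w) (cdr w) then [true] else []

theorem test_pair_eq_iff {q a : Str} : P.test (pair q a) = [true] ↔ P.IsSolution q a := by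
  simp [test]

/-- The final configuration of the universal machine on the instance `X = pair code (pair z T)`,
with answers taken from the table `y`. -/
noncomputable def simulate (X y : Str) : UConfig :=
  (ustep P.test (fun q => lookup q y) (car X))^[(cdr (cdr X)).length] (uinit (car (cdr X)))

theorem polyTime_simulate : PolyTime fun w => encode (car (car w)) (cdr w)
    (P.simulate (car w) (cdr w)) :=
  polyTime_universal P.polyTime_isSolution

theorem exists_isOracle : ∃ O, P.IsOracle O := Classical.axiomOfChoice P.total

/-- The problem of finding a table of answers to the queries in a run of a given oracle machine
on a given input for a given time. -/
noncomputable def universal : TFNP where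
  bound := X * (4 * X + 2 * P.bound + 3)
  rel x y := (P.simulate x y).ok ≠ []
  polyTime := by
    have h := P.polyTime_simulate.cdr.cdr.cdr.cdr
    refine PolyTime.polyTimeDecidable (h.ite_eq (.const []) (.const [false]) (.const [true]))
      fun x y => ?_
    simp only [encode, car_pair, cdr_pair]
    split_ifs <;> simp_all
  total x := by
    obtain ⟨O, hO⟩ := P.exists_isOracle
    have hchk : ∀ q, P.test (pair q (O q)) = [true] := fun q => P.test_pair_eq_iff.mpr (hO q)
    refine ⟨table O ((List.range (cdr (cdr x)).length).map fun i => lookup (unary 1)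
      ((ustep P.test O (car x))^[i] (uinit (car (cdr x)))).mem), ?_, ?_⟩
    · have hlen : (cdr (cdr x)).length ≤ x.length := (length_cdr_le _).trans (length_cdr_le _)
      refine (length_table_le (k := x.length) (m := P.bound.eval x.length) fun q hq => ?_).trans ?_
      · obtain ⟨i, hi, rfl⟩ := List.mem_map.mp hq
        have h1 := length_query_le (chk := P.test) (ans := O) (code := car x) (car (cdr x)) i
        have h2 : i < (cdr (cdr x)).length := List.mem_range.mp hi
        exact ⟨by omega, (hO _).1.trans (eval_le_eval _ (by omega))⟩
      · simp only [List.length_map, List.length_range, eval_mul, eval_add, eval_X, eval_ofNat]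
        exact Nat.mul_le_mul_right _ hlen
    · rw [simulate, iterate_ustep_table, ok_iterate_ustep hchk]
      simp [uinit]

/-- If the table `y` passes the test on the instance for the machine `M`, input `x` and time `|T|`,
then the simulation is a true run of `M` with some oracle that gives solutions to `P`. -/
theorem exists_isOracle_represents {M : Machine} {x T y : Str}
    (h : (P.simulate (pair (codeFrom 0 M) (pair x T)) y).ok ≠ []) :
    ∃ O, P.IsOracle O ∧ Represents (P.simulate (pair (codeFrom 0 M) (pair x T)) y)
      (run M O [x] T.length) := by
  classical
  obtain ⟨O, hO⟩ := P.exists_isOracle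
  refine ⟨fun q => if P.IsSolution q (lookup q y) then lookup q y else O q, fun q => ?_, ?_⟩
  · dsimp only
    split_ifs with hq
    exacts [hq, hO q]
  · unfold simulate at h ⊢
    rw [iterate_ustep_eq_of_ok (O := fun q => if P.IsSolution q (lookup q y) then lookup q y
      else O q) (fun q hq => if_pos (P.test_pair_eq_iff.mp hq))
      (fun w => by unfold test; split_ifs <;> simp) _ h]
    simpa using represents_run P.test M _ x T.length

/-- The reduction of `Q` to `universal P` asks for a table of answers for the run of the machine
that reduces `Q` to `P`, and simulates this run with these answers. -/
theorem PolyReducible.manyOneReducible_universal {P Q : TFNP} (h : Q.PolyReducible P) :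
    Q.ManyOneReducible P.universal := by
  obtain ⟨M, t, hM⟩ := h
  have hf : PolyTime fun x => pair (codeFrom 0 M) (pair x (unary (t.eval x.length))) :=
    .pair (.const _) (.pair .id (.unary_eval t))
  refine manyOneReducible_of_polyTime hf
    (.lookup (.const (unary 0)) P.polyTime_simulate.cdr.cdr.cdr.car) fun x y hy => ?_
  obtain ⟨O, hO, -, hr⟩ := P.exists_isOracle_represents hy.2
  simp only [encode, car_pair, cdr_pair, hr]
  rw [length_unary]
  exact (hM O hO x).2

theorem ManyOneReducible.polyReducible {P Q : TFNP} (h : Q.ManyOneReducible P) :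
    Q.PolyReducible P := by
  obtain ⟨M, t, hM⟩ := h
  exact ⟨M, t, fun O hO x => ⟨(hM O hO x).1, (hM O hO x).2.1⟩⟩

end TFNP

end SearchProblems

theorem mainTheorem10 :
    (∀ P : SearchProblems.TFNP, ∃ P' : SearchProblems.TFNP, ∀ Q : SearchProblems.TFNP,
      Q.PolyReducible P → Q.ManyOneReducible P') ∧
    ((∃ P : SearchProblems.TFNP, ∀ Q : SearchProblems.TFNP, Q.PolyReducible P) ↔
      (∃ P : SearchProblems.TFNP, ∀ Q : SearchProblems.TFNP, Q.ManyOneReducible P)) :=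
  ⟨fun P => ⟨P.universal, fun _ h => h.manyOneReducible_universal⟩,
    fun ⟨P, h⟩ => ⟨P.universal, fun Q => (h Q).manyOneReducible_universal⟩,
    fun ⟨P, h⟩ => ⟨P, fun Q => (h Q).polyReducible⟩⟩
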